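/- All manifolds and tensor fields are smooth; a metric tensor field is a symmetric non-degenerate $(0,2)$-tensor field $g$ of arbitrary signature, with Levi-Civita connection $\nabla$. Conventions: $2\,d\eta(X,Y)=X(\eta(Y))-Y(\eta(X))-\eta([X,Y])$ for a 1-form $\eta$; $N_\varphi(X,Y)=\varphi^2[X,Y]+[\varphi X,\varphi Y]-\varphi[\varphi X,Y]-\varphi[X,\varphi Y]$ for a $(1,1)$-tensor field $\varphi$; $R(X,Y)Z=\nabla_X\nabla_YZ-\nabla_Y\nabla_XZ-\nabla_{[X,Y]}Z$; the Ricci tensor is $\rho(X,Y)=\operatorname{tr}\{Z\mapsto R(Z,X)Y\}$, and the scalar curvature is $\mathrm{Sc}=\sum_i\varepsilon_i\,\rho(E_i,E_i)$ for a local orthonormal frame $(E_i)$ with $\varepsilon_i=g(E_i,E_i)=\pm1$. Put $\tau_1=\tau_2=-1$, $\tau_3=+1$. A mixed metric 3-structure on a manifold $M$ consists of a metric tensor field $g$ and, for $a\in\{1,2,3\}$, a $(1,1)$-tensor field $\varphi_a$, a vector field $\xi_a$ and a 1-form $\eta^a$ such that $\varphi_a^2=-\tau_a(I-\eta^a\otimes\xi_a)$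 and $\eta^a(\xi_a)=1$; such that, for every cyclic permutation $(a,b,c)$ of $(1,2,3)$, $$\varphi_a\varphi_b-\tau_a\eta^b\otimes\xi_a=\tau_c\varphi_c=-\varphi_b\varphi_a+\tau_b\eta^a\otimes\xi_b,\qquad \eta^a\circ\varphi_b=\tau_c\eta^c=-\eta^b\circ\varphi_a,\qquad \varphi_a\xi_b=\tau_b\xi_c,\quad \varphi_b\xi_a=-\tau_a\xi_c;$$ and such that, for every $a$ and all vector fields $X,Y$, $$g(\varphi_aX,\varphi_aY)=\tau_a\bigl(g(X,Y)-\varepsilon_a\,\eta^a(X)\eta^a(Y)\bigr),$$ where $\varepsilon_a=g(\xi_a,\xi_a)$ is constantly $+1$ or constantly $-1$. It is called positive if $g(\xi_1,\xi_1)=g(\xi_2,\xi_2)=+1$, and negative if $g(\xi_1,\xi_1)=g(\xi_2,\xi_2)=-1$. It is called mixed 3-Sasakian if $(\varphi_1,\xi_1,\eta^1,g)$ and $(\varphi_2,\xi_2,\eta^2,g)$ are paraSasakian and $(\varphi_3,\xi_3,\eta^3,g)$ is indefinite Sasakian, that is, if for each $a\in\{1,2,3\}$ $$d\eta^a(X,Y)=g(X,\varphi_aY)\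 \text{ for all vector fields } X,Y,\qquad\text{and}\qquad N_{\varphi_a}+2\tau_a\,d\eta^a\otimes\xi_a=0 .$$ **Proposition.** Let $n\ge 0$ and let $(M^{4n+3},\varphi_a,\xi_a,\eta^a,g)$ be a mixed 3-Sasakian manifold. Then the 3-structure is either positive or negative, and $M$ has constant scalar curvature $$\mathrm{Sc}=-\sigma(4n+2)(4n+3),$$ where $\sigma=+1$ if the 3-structure is positive and $\sigma=-1$ if it is negative. In particular the scalar curvature is negative if the 3-structure is positive, and positive if the 3-structure is negative. -/

import Mathlib

open scoped Manifold ContDiff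
open Bundle

noncomputable section

namespace MixedThreeSasakian

/-! ### Curvature of a metric on a vector space

`G` is a field of bilinear forms on `E`, that is, a metric in a chart. All derivatives are taken at
points near which `G` and the vector fields are smooth. -/

section Coordinates

variable {E : Type*} [NormedAddCommGroup E] [NormedSpace ℝ E]

/-- The Christoffel symbols `Γ(u, v) = Γ^k_{ij} u^i v^j` of `G` at `y`:
`2 G(Γ(u, v), w) = (∂_u G)(v, w) + (∂_v G)(u, w) - (∂_w G)(u, v)` for all `w`. -/
def christoffel (G : E → E →L[ℝ] E →L[ℝ] ℝ) (y u v : E) : E :=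
  (G y).inverse ((1 / 2 : ℝ) •
    (fderiv ℝ G y u v + fderiv ℝ G y v u - ((fderiv ℝ G y).flip u).flip v))

/-- The Levi-Civita connection of `G`: `∇_X Y = ∂_X Y + Γ(X, Y)`. -/
def leviCivita (G : E → E →L[ℝ] E →L[ℝ] ℝ) (X Y : E → E) (y : E) : E :=
  fderiv ℝ Y y (X y) + christoffel G y (X y) (Y y)

/-- The curvature `R(X, Y) Z = ∇_X ∇_Y Z - ∇_Y ∇_X Z - ∇_{[X, Y]} Z`. -/
def curvature (G : E → E →L[ℝ] E →L[ℝ] ℝ) (X Y Z : E → E) (y : E) : E :=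
  leviCivita G X (leviCivita G Y Z) y - leviCivita G Y (leviCivita G X Z) y
    - leviCivita G (VectorField.lieBracket ℝ X Y) Z y

variable [FiniteDimensional ℝ E]

/-- The Ricci tensor `ρ(v, w) = tr (z ↦ R(z, v) w)` at `y`. The vectors are extended to constant
fields, and the trace is computed in a basis. -/
def ricci (G : E → E →L[ℝ] E →L[ℝ] ℝ) (y v w : E) : ℝ :=
  ∑ i, (Module.finBasis ℝ E).coord i
    (curvature G (fun _ => Module.finBasis ℝ E i) (fun _ => v) (fun _ => w) y)

/-- The scalar curvature `g^{ij} ρ_{ij}` at `y`: the trace of the Ricci tensor with respect to `G`.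
The vector `∑ⱼ g^{ij} bⱼ` is the one which corresponds to the `i`-th coordinate form under `G`.
In an orthonormal basis `(eᵢ)` of `G y` with `εᵢ = G y eᵢ eᵢ` this is `∑ᵢ εᵢ ρ(eᵢ, eᵢ)`. -/
def scalar (G : E → E →L[ℝ] E →L[ℝ] ℝ) (y : E) : ℝ :=
  ∑ i, ricci G y (Module.finBasis ℝ E i)
    ((G y).inverse (LinearMap.toContinuousLinearMap ((Module.finBasis ℝ E).coord i)))

end Coordinates

/-! ### Tensor fields on a manifold -/

section Manifold

variable (E : Type*) [NormedAddCommGroup E] [NormedSpace ℝ E]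
  (M : Type*) [TopologicalSpace M] [ChartedSpace E M]

/-- A metric tensor field: a smooth symmetric non-degenerate `(0,2)`-tensor field, of arbitrary
signature. -/
structure MetricTensor [IsManifold 𝓘(ℝ, E) ∞ M] where
  val : ∀ x : M, TangentSpace 𝓘(ℝ, E) x →L[ℝ] TangentSpace 𝓘(ℝ, E) x →L[ℝ] ℝ
  symm : ∀ (x : M) (v w : TangentSpace 𝓘(ℝ, E) x), val x v w = val x w v
  nondegenerate : ∀ (x : M) (v : TangentSpace 𝓘(ℝ, E) x), (∀ w, val x v w = 0) → v = 0
  contMDiff : ContMDiff 𝓘(ℝ, E) (𝓘(ℝ, E).prod 𝓘(ℝ, E →L[ℝ] E →L[ℝ] ℝ)) ∞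
    (fun x => TotalSpace.mk' (E →L[ℝ] E →L[ℝ] ℝ)
      (E := fun x : M => TangentSpace 𝓘(ℝ, E) x →L[ℝ] TangentSpace 𝓘(ℝ, E) x →L[ℝ] ℝ) x (val x))

/-- A triple `(φ, ξ, η)` of a smooth `(1,1)`-tensor field, a smooth vector field and a smooth
`1`-form, without any relation between them. -/
structure TensorTriple [IsManifold 𝓘(ℝ, E) ∞ M] where
  φ : ∀ x : M, TangentSpace 𝓘(ℝ, E) x →L[ℝ] TangentSpace 𝓘(ℝ, E) x
  ξ : ∀ x : M, TangentSpace 𝓘(ℝ, E) x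
  η : ∀ x : M, TangentSpace 𝓘(ℝ, E) x →L[ℝ] ℝ
  contMDiff_φ : ContMDiff 𝓘(ℝ, E) (𝓘(ℝ, E).prod 𝓘(ℝ, E →L[ℝ] E)) ∞
    (fun x => TotalSpace.mk' (E →L[ℝ] E)
      (E := fun x : M => TangentSpace 𝓘(ℝ, E) x →L[ℝ] TangentSpace 𝓘(ℝ, E) x) x (φ x))
  contMDiff_ξ : ContMDiff 𝓘(ℝ, E) (𝓘(ℝ, E).prod 𝓘(ℝ, E)) ∞
    (fun x => TotalSpace.mk' E (E := fun x : M => TangentSpace 𝓘(ℝ, E) x) x (ξ x))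
  contMDiff_η : ContMDiff 𝓘(ℝ, E) (𝓘(ℝ, E).prod 𝓘(ℝ, E →L[ℝ] ℝ)) ∞
    (fun x => TotalSpace.mk' (E →L[ℝ] ℝ)
      (E := fun x : M => TangentSpace 𝓘(ℝ, E) x →L[ℝ] ℝ) x (η x))

variable {E M}

/-- The vector field `X` is smooth on the set `U`. -/
def SmoothFieldOn [IsManifold 𝓘(ℝ, E) ∞ M]
    (U : Set M) (X : ∀ x : M, TangentSpace 𝓘(ℝ, E) x) : Prop :=
  ContMDiffOn 𝓘(ℝ, E) (𝓘(ℝ, E).prod 𝓘(ℝ, E)) ∞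
    (fun x => TotalSpace.mk' E (E := fun x : M => TangentSpace 𝓘(ℝ, E) x) x (X x)) U

/-- The exterior derivative of a `1`-form, with the normalization
`2 dη(X, Y) = X(η(Y)) - Y(η(X)) - η([X, Y])`. -/
def extDerivOne (η : ∀ x : M, TangentSpace 𝓘(ℝ, E) x →L[ℝ] ℝ)
    (X Y : ∀ x : M, TangentSpace 𝓘(ℝ, E) x) (x : M) : ℝ :=
  (1 / 2 : ℝ) * (mvfderiv 𝓘(ℝ, E) (fun p => η p (Y p)) x (X x)
    - mvfderiv 𝓘(ℝ, E) (fun p => η p (X p)) x (Y x)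
    - η x (VectorField.mlieBracket 𝓘(ℝ, E) X Y x))

/-- The Nijenhuis tensor
`N_φ(X, Y) = φ²[X, Y] + [φX, φY] - φ[φX, Y] - φ[X, φY]`. -/
def nijenhuis (φ : ∀ x : M, TangentSpace 𝓘(ℝ, E) x →L[ℝ] TangentSpace 𝓘(ℝ, E) x)
    (X Y : ∀ x : M, TangentSpace 𝓘(ℝ, E) x) (x : M) : TangentSpace 𝓘(ℝ, E) x :=
  φ x (φ x (VectorField.mlieBracket 𝓘(ℝ, E) X Y x))
    + VectorField.mlieBracket 𝓘(ℝ, E) (fun p => φ p (X p)) (fun p => φ p (Y p)) x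
    - φ x (VectorField.mlieBracket 𝓘(ℝ, E) (fun p => φ p (X p)) Y x)
    - φ x (VectorField.mlieBracket 𝓘(ℝ, E) X (fun p => φ p (Y p)) x)

variable [IsManifold 𝓘(ℝ, E) ∞ M]

/-! ### Scalar curvature -/

/-- The expression of the metric `g` in the preferred chart at `p`: the bilinear form on `E`
obtained at `y` by pulling `g` back along the inverse of the chart. -/
def MetricTensor.inChart (g : MetricTensor E M) (p : M) (y : E) : E →L[ℝ] E →L[ℝ] ℝ :=
  let D : E →L[ℝ] E := mfderiv 𝓘(ℝ, E) 𝓘(ℝ, E) (extChartAt 𝓘(ℝ, E) p).symm y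
  let B : E →L[ℝ] E →L[ℝ] ℝ := g.val ((extChartAt 𝓘(ℝ, E) p).symm y)
  B.bilinearComp D D

/-- The scalar curvature of `g` at `p`, computed in the preferred chart at `p`. -/
def MetricTensor.scalarCurvature [FiniteDimensional ℝ E] (g : MetricTensor E M) (p : M) : ℝ :=
  scalar (g.inChart p) (extChartAt 𝓘(ℝ, E) p p)

/-! ### Almost (para)contact metric structures -/

/-- `φ² = I - η ⊗ ξ` and `η(ξ) = 1`. -/
def TensorTriple.IsAlmostParacontact (S : TensorTriple E M) : Prop :=
  ∀ x : M, S.η x (S.ξ x) = 1 ∧ ∀ v, S.φ x (S.φ x v) = v - S.η x v • S.ξ x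

/-- `φ² = -I + η ⊗ ξ` and `η(ξ) = 1`. -/
def TensorTriple.IsAlmostContact (S : TensorTriple E M) : Prop :=
  ∀ x : M, S.η x (S.ξ x) = 1 ∧ ∀ v, S.φ x (S.φ x v) = -v + S.η x v • S.ξ x

/-- The metric `g` is compatible with `(φ, ξ, η)`:
`g(φX, φY) = r (g(X, Y) - ε η(X) η(Y))`, where `ε = g(ξ, ξ)` is constantly `1` or constantly `-1`.
Here `r = -1` for almost paracontact and `r = 1` for almost contact structures. -/
def TensorTriple.IsCompatible (S : TensorTriple E M) (r : ℝ) (g : MetricTensor E M) : Prop :=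
  ∃ ε : ℝ, (ε = 1 ∨ ε = -1) ∧ ∀ x : M, g.val x (S.ξ x) (S.ξ x) = ε ∧
    ∀ v w, g.val x (S.φ x v) (S.φ x w) = r * (g.val x v w - ε * (S.η x v * S.η x w))

/-- `dη = Φ`, where `Φ(X, Y) = g(X, φY)`. -/
def TensorTriple.IsContactForm (S : TensorTriple E M) (g : MetricTensor E M) : Prop :=
  ∀ (U : Set M), IsOpen U → ∀ X Y : (∀ x : M, TangentSpace 𝓘(ℝ, E) x),
    SmoothFieldOn U X → SmoothFieldOn U Y →
      ∀ x ∈ U, extDerivOne S.η X Y x = g.val x (X x) (S.φ x (Y x))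

/-- Normality `N_φ + 2 r dη ⊗ ξ = 0`: for `r = -1` this is `N_φ = 2 dη ⊗ ξ`, normality of an
almost paracontact structure, and for `r = 1` it is `N_φ + 2 dη ⊗ ξ = 0`, normality of an almost
contact structure. -/
def TensorTriple.IsNormal (S : TensorTriple E M) (r : ℝ) : Prop :=
  ∀ (U : Set M), IsOpen U → ∀ X Y : (∀ x : M, TangentSpace 𝓘(ℝ, E) x),
    SmoothFieldOn U X → SmoothFieldOn U Y →
      ∀ x ∈ U, nijenhuis S.φ X Y x + (2 * r * extDerivOne S.η X Y x) • S.ξ x = 0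

/-- `(φ, ξ, η, g)` is a paraSasakian structure. -/
def TensorTriple.IsParaSasakian (S : TensorTriple E M) (g : MetricTensor E M) : Prop :=
  S.IsAlmostParacontact ∧ S.IsCompatible (-1) g ∧ S.IsContactForm g ∧ S.IsNormal (-1)

/-- `(φ, ξ, η, g)` is an indefinite Sasakian structure. -/
def TensorTriple.IsIndefiniteSasakian (S : TensorTriple E M) (g : MetricTensor E M) : Prop :=
  S.IsAlmostContact ∧ S.IsCompatible 1 g ∧ S.IsContactForm g ∧ S.IsNormal 1

/-! ### Mixed 3-structures

The indices `0, 1, 2 : Fin 3` stand for the usual indices `1, 2, 3`. -/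

/-- The signs `τ₁ = τ₂ = -1` and `τ₃ = 1`. -/
def τ : Fin 3 → ℝ := ![-1, -1, 1]

/-- A mixed 3-structure `(φ_a, ξ_a, η^a)`. In `relations`, `(a, a + 1, a + 2)` runs over the cyclic
permutations of the three indices. -/
structure IsMixedStructure (S : Fin 3 → TensorTriple E M) : Prop where
  paracontact₁ : (S 0).IsAlmostParacontact
  paracontact₂ : (S 1).IsAlmostParacontact
  contact₃ : (S 2).IsAlmostContact
  relations : ∀ a b c : Fin 3, b = a + 1 → c = a + 2 → ∀ x : M,
    (∀ v, (S a).φ x ((S b).φ x v) - (τ a * (S b).η x v) • (S a).ξ x = τ c • (S c).φ x v) ∧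
    (∀ v, -(S b).φ x ((S a).φ x v) + (τ b * (S a).η x v) • (S b).ξ x = τ c • (S c).φ x v) ∧
    (∀ v, (S a).η x ((S b).φ x v) = τ c * (S c).η x v) ∧
    (∀ v, -(S b).η x ((S a).φ x v) = τ c * (S c).η x v) ∧
    (S a).φ x ((S b).ξ x) = τ b • (S c).ξ x ∧
    (S b).φ x ((S a).ξ x) = -(τ a • (S c).ξ x)

/-- A mixed metric 3-structure `(φ_a, ξ_a, η^a, g)`. -/
structure IsMixedMetricStructure (g : MetricTensor E M) (S : Fin 3 → TensorTriple E M) :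
    Prop where
  mixed : IsMixedStructure S
  compatible : ∀ a : Fin 3, (S a).IsCompatible (τ a) g

/-- A mixed 3-Sasakian structure `(φ_a, ξ_a, η^a, g)`. -/
structure IsMixedThreeSasakian (g : MetricTensor E M) (S : Fin 3 → TensorTriple E M) :
    Prop where
  mixedMetric : IsMixedMetricStructure g S
  paraSasakian₁ : (S 0).IsParaSasakian g
  paraSasakian₂ : (S 1).IsParaSasakian g
  sasakian₃ : (S 2).IsIndefiniteSasakian g

/-- The 3-structure is positive: `g(ξ₁, ξ₁) = g(ξ₂, ξ₂) = 1`. -/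
def IsPositive (g : MetricTensor E M) (S : Fin 3 → TensorTriple E M) : Prop :=
  ∀ x : M, g.val x ((S 0).ξ x) ((S 0).ξ x) = 1 ∧ g.val x ((S 1).ξ x) ((S 1).ξ x) = 1

/-- The 3-structure is negative: `g(ξ₁, ξ₁) = g(ξ₂, ξ₂) = -1`. -/
def IsNegative (g : MetricTensor E M) (S : Fin 3 → TensorTriple E M) : Prop :=
  ∀ x : M, g.val x ((S 0).ξ x) ((S 0).ξ x) = -1 ∧ g.val x ((S 1).ξ x) ((S 1).ξ x) = -1

end Manifold

end MixedThreeSasakian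

end

/-! The metric is Einstein, because subtracting the curvature of a space form from `R` leaves a
Ricci-flat tensor.

For one (para)Sasakian structure with sign `r = τ_a` and `ε = g(ξ, ξ)`, normality and `dη = Φ` force
`∇_u ξ = -ε φ u` and `(∇_u φ) v = r (g(u, v) ξ - ε η(v) u)` (`LinearSasakian.A_eq`,
`LinearSasakian.P_eq`). The Ricci identities then give `R(u, v) ξ = r (η(v) u - η(u) v)`, and they
show that `R(u, v)` and `r ε C(u, v)` have the same commutator with `φ`, where `C(u, v) w = g(v, w)
u - g(u, w) v` (`curvature_ξ`, `curvature_φ`).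

The relations between the `ξ_a` give `ε₁ = ε₂ = -ε₃`, so `K = τ_a ε_a = -ε₁` does not depend on `a`.
Hence `T = R - K C` is an algebraic curvature tensor that kills every `ξ_a` and commutes with every
`φ_a`.

Such a `T` has zero Ricci tensor (`trace_ricciMap_eq_zero`). Up to terms along `ξ_a`, the map `φ₃`
is both `φ₁φ₂` and `-φ₂φ₁`, so cyclicity of the trace gives `tr(φ₃ T(u, v)) = 0`. As for a Kähler
metric, the Bianchi identity identifies these traces with twice the Ricci tensor up to sign and a
twist by `φ₃`. Therefore the Ricci tensor of `R` is `K (dim - 1) g`, and its trace is `K (dim - 1)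
dim`.

The pointwise identities are proved in a chart, where covariant derivatives are explicit; the
hypotheses reach the chart through coordinate vector fields. -/

namespace MixedThreeSasakian

/-! ### Linear algebra of one (para)Sasakian structure at a point. -/

section Pointwise

variable {E : Type*} [NormedAddCommGroup E] [NormedSpace ℝ E]

/-- An almost contact (`r = 1`) or almost paracontact (`r = -1`) metric structure on a vector
space. -/
structure LinearStructure (g : E →L[ℝ] E →L[ℝ] ℝ) (φ : E →L[ℝ] E) (ξ : E) (η : E →L[ℝ] ℝ)
    (r ε : ℝ) : Prop where
  symm : ∀ u v, g u v = g v u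
  nondegenerate : ∀ u, (∀ v, g u v = 0) → u = 0
  r_mul_r : r * r = 1
  ε_mul_ε : ε * ε = 1
  η_ξ : η ξ = 1
  φ_φ : ∀ v, φ (φ v) = -(r • (v - η v • ξ))
  g_ξ_ξ : g ξ ξ = ε
  g_φ_φ : ∀ u v, g (φ u) (φ v) = r * (g u v - ε * (η u * η v))

namespace LinearStructure

variable {g : E →L[ℝ] E →L[ℝ] ℝ} {φ : E →L[ℝ] E} {ξ : E} {η : E →L[ℝ] ℝ} {r ε : ℝ}

lemma r_ne_zero (h : LinearStructure g φ ξ η r ε) : r ≠ 0 := by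
  intro h0; simpa [h0] using h.r_mul_r

/-- Since `φ (φ ξ) = 0`, the formula for `φ²` at `φ ξ` makes `φ ξ` a multiple of `ξ`; applying `φ`
once more shows that the square of the factor is zero. -/
lemma φ_ξ (h : LinearStructure g φ ξ η r ε) : φ ξ = 0 := by
  have h1 : φ (φ ξ) = 0 := by simp [h.φ_φ, h.η_ξ]
  have h2 := h.φ_φ (φ ξ)
  rw [h1, map_zero, eq_comm, neg_eq_zero, smul_eq_zero, sub_eq_zero] at h2
  have h3 := h2.resolve_left h.r_ne_zero
  have h4 : η (φ ξ) * η (φ ξ) = 0 := by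
    have := congrArg φ h3
    rw [h1, map_smul, h3, smul_smul] at this
    have := congrArg η this
    simpa [h.η_ξ] using this.symm
  rw [h3, mul_self_eq_zero.1 h4, zero_smul]

/-- Two evaluations of `φ³ v`, as `φ (φ² v)` and as `φ² (φ v)`, differ by a multiple of `η (φ v) •
ξ`. -/
lemma η_φ (h : LinearStructure g φ ξ η r ε) (v : E) : η (φ v) = 0 := by
  have h1 := h.φ_φ (φ v)
  rw [h.φ_φ v] at h1
  have h2 := congrArg η h1
  simp only [map_neg, map_smul, map_sub, h.φ_ξ, smul_zero, sub_zero] at h1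
  rw [neg_inj] at h1
  have h3 := smul_right_injective E h.r_ne_zero h1
  have h4 := congrArg η h3
  simp only [map_sub, map_smul, h.η_ξ, smul_eq_mul] at h4
  linarith

lemma g_ξ (h : LinearStructure g φ ξ η r ε) (v : E) : g ξ v = ε * η v := by
  have h1 := h.g_φ_φ ξ v
  rw [h.φ_ξ, h.η_ξ, map_zero, zero_apply, eq_comm, mul_eq_zero] at h1
  have := h1.resolve_left h.r_ne_zero
  linarith

lemma η_eq (h : LinearStructure g φ ξ η r ε) (v : E) : η v = ε * g ξ v := by
  rw [h.g_ξ, ← mul_assoc, h.ε_mul_ε, one_mul]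

lemma g_φ (h : LinearStructure g φ ξ η r ε) (u v : E) : g (φ u) v = -g u (φ v) := by
  have h1 := h.g_φ_φ u (φ v)
  rw [h.φ_φ, h.η_φ] at h1
  simp only [map_neg, map_smul, map_sub, smul_eq_mul, h.symm _ ξ, h.g_ξ, h.η_φ] at h1
  have := mul_left_cancel₀ h.r_ne_zero
    (show r * g (φ u) v = r * (-g u (φ v)) by linarith)
  exact this

lemma eq_of_forall (h : LinearStructure g φ ξ η r ε) {u v : E} (H : ∀ w, g u w = g v w) :
    u = v := by
  rw [← sub_eq_zero]
  exact h.nondegenerate _ fun w => by simp [H w]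

lemma eq_sub (h : LinearStructure g φ ξ η r ε) (v : E) : v = η v • ξ - r • φ (φ v) := by
  rw [h.φ_φ, smul_neg, smul_smul, h.r_mul_r]; simp

end LinearStructure

/-- The pointwise content of a (para)Sasakian structure: `P u v` stands for `(∇_u φ) v` and `A u`
for `∇_u ξ`. -/
structure LinearSasakian (g : E →L[ℝ] E →L[ℝ] ℝ) (φ : E →L[ℝ] E) (ξ : E) (η : E →L[ℝ] ℝ)
    (r ε : ℝ) (P : E →L[ℝ] E →L[ℝ] E) (A : E →L[ℝ] E) : Prop
    extends LinearStructure g φ ξ η r ε where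
  skew : ∀ u v w, g (P u v) w = -g v (P u w)
  closed : ∀ u v w, g (P u v) w + g (P v w) u + g (P w u) v = 0
  normal : ∀ v w, P (φ v) w - P (φ w) v + φ (P w v) - φ (P v w) + (2 * r * g v (φ w)) • ξ = 0
  P_φ : ∀ u v, P u (φ v) + φ (P u v) = r • ((ε * g (A u) v) • ξ + η v • A u)
  φ_A : ∀ u, φ (A u) + P u ξ = 0
  g_A_ξ : ∀ u, g (A u) ξ = 0
  contact : ∀ u v, ε * (g (A u) v - g (A v) u) = 2 * g u (φ v)

namespace LinearSasakian

variable {g : E →L[ℝ] E →L[ℝ] ℝ} {φ : E →L[ℝ] E} {ξ : E} {η : E →L[ℝ] ℝ} {r ε : ℝ}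
  {P : E →L[ℝ] E →L[ℝ] E} {A : E →L[ℝ] E}

lemma A_ξ (h : LinearSasakian g φ ξ η r ε P A) : A ξ = 0 := by
  refine h.nondegenerate _ fun v => ?_
  have h1 := h.contact ξ v
  rw [h.g_A_ξ, h.g_ξ, h.η_φ, sub_zero] at h1
  have : ε * ε * g (A ξ) v = 0 := by linear_combination ε * h1
  simpa [h.ε_mul_ε] using this

/-- This is the vanishing of the Lie derivative of `φ` along `ξ`. Normality with first argument `ξ`
shows that `φ` kills the difference `z` of the two sides; moreover `η z = 0`, and the two together
force `z = 0`. -/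
lemma P_ξ_left (h : LinearSasakian g φ ξ η r ε P A) (w : E) :
    P ξ w = A (φ w) - φ (A w) := by
  have hA : ∀ u, P u ξ = -φ (A u) := fun u => by
    rw [eq_neg_iff_add_eq_zero, add_comm]; exact h.φ_A u
  have h1 := h.normal ξ w
  rw [h.φ_ξ, h.g_ξ, h.η_φ, hA, hA] at h1
  set z := A (φ w) - φ (A w) - P ξ w with hz
  have h2 : φ z = 0 := by
    rw [hz, map_sub, map_sub, ← h1]; simp; abel
  have h3 : η z = 0 := by
    rw [h.η_eq, hz, map_sub, map_sub, h.symm ξ (A _), h.g_A_ξ, h.g_ξ, h.η_φ,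
      h.symm, h.skew, hA, h.A_ξ]
    simp
  have h4 := h.eq_sub z
  rw [h2, h3] at h4
  have : z = 0 := by rw [h4]; simp
  rw [hz, sub_eq_zero] at this
  exact this.symm

/-- The field `ξ` is Killing. On the image of `φ` this is closedness of the fundamental form with
one argument equal to `ξ`; in the direction of `ξ` both terms vanish. -/
lemma g_A_symm (h : LinearSasakian g φ ξ η r ε P A) (u v : E) : g (A u) v + g (A v) u = 0 := by
  have hφ : ∀ v w, g (A (φ v)) w + g (A w) (φ v) = 0 := fun v w => by
    have h1 := h.closed ξ v w
    have hA : P w ξ = -φ (A w) := by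
      rw [eq_neg_iff_add_eq_zero, add_comm]; exact h.φ_A w
    have hA' : P v ξ = -φ (A v) := by
      rw [eq_neg_iff_add_eq_zero, add_comm]; exact h.φ_A v
    rw [h.P_ξ_left, h.skew v w ξ, hA, hA'] at h1
    simp only [map_sub, map_neg, sub_apply, neg_apply,
      h.g_φ (A w)] at h1
    rw [h.symm w] at h1
    linarith
  rw [h.eq_sub u]
  have := hφ (φ u) v
  simp only [map_sub, map_smul, sub_apply, smul_apply,
    h.A_ξ, smul_eq_mul, h.g_A_ξ, map_zero, smul_zero]
  simp only [zero_apply]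
  linear_combination (-r) * this

/-- The contact condition fixes the skew part of `g (A u) v`, and the Killing property removes the
symmetric part. -/
lemma A_eq (h : LinearSasakian g φ ξ η r ε P A) (u : E) : A u = -(ε • φ u) := by
  refine h.eq_of_forall fun w => ?_
  have h1 := h.contact u w
  have h2 := h.g_A_symm u w
  simp only [map_neg, map_smul, neg_apply, smul_apply,
    smul_eq_mul, h.g_φ]
  linear_combination ε / 2 * h1 + 1 / 2 * h2 - (g (A u) w - g (A w) u) / 2 * h.ε_mul_ε

/-- The covariant derivative of `φ` of a (para)Sasakian structure. -/
lemma P_eq (h : LinearSasakian g φ ξ η r ε P A) (u v : E) :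
    P u v = r • (g u v • ξ - (ε * η v) • u) := by
  -- The defect `Q` satisfies homogeneous versions of the identities for `P`: it is skew and cyclic,
  -- anticommutes with `φ`, and satisfies normality without the `ξ` term.
  let Q : E → E → E := fun u v => P u v - r • (g u v • ξ - (ε * η v) • u)
  have gQ : ∀ u v w, g (Q u v) w = g (P u v) w - r * (g u v * (ε * η w) - ε * η v * g u w) := by
    intro u v w
    simp [Q, h.g_ξ]
  have skew : ∀ u v w, g (Q u v) w = -g (Q u w) v := fun u v w => by
    rw [gQ, gQ, h.skew, h.symm v]; ring
  have closed : ∀ u v w, g (Q u v) w + g (Q v w) u + g (Q w u) v = 0 := fun u v w => by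
    rw [gQ, gQ, gQ, h.symm w u, h.symm w v, h.symm v u]; linear_combination h.closed u v w
  have hφ : ∀ u v w, g (Q u (φ v)) w = g (Q u v) (φ w) := fun u v w => by
    have h1 := congrArg (fun z => g z w) (h.P_φ u v)
    simp only [h.A_eq, map_add, map_smul, add_apply, map_neg,
      smul_apply, neg_apply, smul_eq_mul, h.g_φ,
      h.g_ξ] at h1
    rw [gQ, gQ, h.η_φ, h.η_φ]
    linear_combination h1 + r * g u (φ v) * η w * h.ε_mul_ε * ε
  have normal : ∀ v w z, g (Q (φ v) w) z - g (Q (φ w) v) z - g (Q w v) (φ z)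
      + g (Q v w) (φ z) = 0 := fun v w z => by
    have h1 := congrArg (fun y => g y z) (h.normal v w)
    simp only [map_add, map_smul, add_apply, map_sub,
      smul_apply, sub_apply, smul_eq_mul, h.g_φ,
      h.g_ξ, map_zero, zero_apply] at h1
    rw [gQ, gQ, gQ, gQ, h.η_φ, h.g_φ, h.g_φ, h.g_φ, h.g_φ, h.symm w (φ v), h.g_φ, h.symm v w]
    linear_combination h1
  -- This is the argument by which an integrable almost complex structure with closed fundamental
  -- form is parallel.
  have key : ∀ z v w, g (Q z v) (φ w) = 0 := fun z v w => by
    have h1 := normal v w z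
    have h2 := closed (φ v) w z
    have h3 := closed v (φ w) z
    have h4 := skew (φ w) z v
    have h5 := hφ v w z
    have h6 := hφ w v z
    have h7 := skew w z (φ v)
    have h8 := skew z (φ v) w
    have h9 := hφ z v w
    linarith
  have Qξ : ∀ z v, g (Q z v) ξ = 0 := fun z v => by
    have hA : P z ξ = -φ (A z) := by
      rw [eq_neg_iff_add_eq_zero, add_comm]; exact h.φ_A z
    rw [skew, gQ, hA, h.A_eq, h.η_ξ, h.symm z ξ, h.g_ξ]
    simp only [map_neg, map_smul, map_sub, neg_apply, neg_neg, h.φ_φ, smul_apply, sub_apply,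
      smul_eq_mul, h.g_ξ]
    ring
  have hQ : Q u v = 0 := by
    refine h.nondegenerate _ fun w => ?_
    rw [h.eq_sub w]
    simp [key, Qξ]
  exact sub_eq_zero.1 hQ

end LinearSasakian

end Pointwise

/-! ### Algebraic curvature tensors compatible with a mixed 3-structure. -/

section AlgebraicCurvature

variable {E : Type*} [NormedAddCommGroup E] [NormedSpace ℝ E]

/-- An algebraic curvature tensor of type `(1,3)` with respect to the bilinear form `g`. -/
structure IsAlgebraicCurvature (g : E →L[ℝ] E →L[ℝ] ℝ) (T : E →L[ℝ] E →L[ℝ] E →L[ℝ] E) :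
    Prop where
  swap : ∀ u v w, T v u w = -T u v w
  bianchi : ∀ u v w, T u v w + T v w u + T w u v = 0
  skew : ∀ u v w z, g (T u v w) z = -g w (T u v z)

variable {g : E →L[ℝ] E →L[ℝ] ℝ} {T : E →L[ℝ] E →L[ℝ] E →L[ℝ] E}

/-- The octahedron argument: four Bianchi identities are added after matching terms by the two skew
symmetries. -/
lemma IsAlgebraicCurvature.pair_symm (h : IsAlgebraicCurvature g T)
    (hg : ∀ u v, g u v = g v u) (u v w z : E) : g (T u v w) z = g (T w z u) v := by
  have hs : ∀ u v w z, g (T u v w) z = -g (T u v z) w := fun u v w z => by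
    rw [h.skew, hg w]
  have hw : ∀ u v w z, g (T u v w) z = -g (T v u w) z := fun u v w z => by
    rw [h.swap v u]; simp
  have hb : ∀ u v w z, g (T u v w) z + g (T v w u) z + g (T w u v) z = 0 := fun u v w z => by
    have := congrArg (fun y => g y z) (h.bianchi u v w)
    simpa using this
  linarith [hb u v w z, hb v w z u, hb w z u v, hb z u v w,
    hs u v w z, hs v w u z, hs w u v z, hs v w z u, hs w z v u, hs z v w u,
    hs w z u v, hs z u w v, hs u w z v, hs z u v w, hs u v z w, hs v z u w,
    hw u v w z, hw v w u z, hw w u v z, hw v w z u, hw w z v u, hw z v w u,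
    hw w z u v, hw z u w v, hw u w z v, hw z u v w, hw u v z w, hw v z u w]

/-- Pair symmetry carries `f` from the first slot to the third, where it commutes with `T`; it
returns in the second slot with a sign because it is skew for `g`. -/
lemma IsAlgebraicCurvature.apply_left_of_commute (h : IsAlgebraicCurvature g T)
    {f : E →L[ℝ] E} {ζ : E} {θ : E →L[ℝ] ℝ} {r e : ℝ}
    (hL : LinearStructure g f ζ θ r e) (hf : ∀ u v w, T u v (f w) = f (T u v w)) (u v w : E) :
    T (f u) v w = -T u (f v) w :=
  hL.eq_of_forall fun z => by
    rw [g.map_neg₂, h.pair_symm hL.symm, hf, hL.g_φ, h.pair_symm hL.symm u]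

/-- The endomorphism `u ↦ T(u, v) w`, whose trace is the Ricci tensor of `T`. -/
noncomputable def ricciMap (T : E →L[ℝ] E →L[ℝ] E →L[ℝ] E) (v w : E) : E →L[ℝ] E := (T.flip v).flip w

@[simp] lemma ricciMap_apply (T : E →L[ℝ] E →L[ℝ] E →L[ℝ] E) (u v w : E) :
    ricciMap T v w u = T u v w := rfl

lemma trace_comp_comm (A B : E →L[ℝ] E) :
    LinearMap.trace ℝ E (A ∘L B : E →L[ℝ] E) = LinearMap.trace ℝ E (B ∘L A : E →L[ℝ] E) :=
  LinearMap.trace_mul_comm ℝ (A : E →ₗ[ℝ] E) (B : E →ₗ[ℝ] E)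

variable {φ : Fin 3 → E →L[ℝ] E} {ξ : Fin 3 → E} {η : Fin 3 → E →L[ℝ] ℝ} {ε : Fin 3 → ℝ}

/-- A map which commutes with a mixed 3-structure and annihilates its vectors is orthogonal to
`φ₃` for the trace form. -/
lemma trace_comp_φ_eq_zero {A : E →L[ℝ] E} {a b s : ℝ} (hs : s ≠ 0)
    (h₁ : ∀ v, φ 0 (φ 1 v) - (a * η 1 v) • ξ 0 = s • φ 2 v)
    (h₂ : ∀ v, -φ 1 (φ 0 v) + (b * η 0 v) • ξ 1 = s • φ 2 v)
    (hξ : ∀ i, A (ξ i) = 0) (hφ : ∀ i v, A (φ i v) = φ i (A v)) :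
    LinearMap.trace ℝ E (φ 2 ∘L A : E →L[ℝ] E) = 0 := by
  have e1 : A ∘L (φ 0 ∘L φ 1) = s • (φ 2 ∘L A) := by
    ext v
    have := congrArg A (h₁ v)
    simpa [hξ, hφ 2] using this
  have e2 : A ∘L (φ 1 ∘L φ 0) = -(s • (φ 2 ∘L A)) := by
    ext v
    have := congrArg A (h₂ v)
    simp only [map_add, map_neg, map_smul, hξ, smul_zero, add_zero, hφ 2] at this
    simp [← this]
  have e3 : A ∘L (φ 1 ∘L φ 0) = φ 1 ∘L (A ∘L φ 0) := by
    ext v; simp [hφ]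
  have e4 : (A ∘L φ 0) ∘L φ 1 = A ∘L (φ 0 ∘L φ 1) := rfl
  -- Cyclicity equates the traces of `A φ₁ φ₀` and `A φ₀ φ₁` (code indices). Since `A` kills the `ξ`
  -- terms, these maps are `-s φ₂ A` and `s φ₂ A`.
  have h := trace_comp_comm (φ 1) (A ∘L φ 0)
  rw [← e3, e4, e1, e2] at h
  simp only [ContinuousLinearMap.toLinearMap_neg, ContinuousLinearMap.toLinearMap_smul, map_neg,
    map_smul, smul_eq_mul] at h
  have : s * LinearMap.trace ℝ E (φ 2 ∘L A : E →L[ℝ] E) = 0 := by linarith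
  exact (mul_eq_zero.1 this).resolve_left hs

variable [FiniteDimensional ℝ E]

/-- A map which is skew with respect to a non-degenerate bilinear form has trace zero. -/
lemma trace_eq_zero_of_skew (hn : ∀ u, (∀ v, g u v = 0) → u = 0) {A : E →L[ℝ] E}
    (hA : ∀ u v, g (A u) v = -g u (A v)) : LinearMap.trace ℝ E (A : E →ₗ[ℝ] E) = 0 := by
  let G : E →ₗ[ℝ] Module.Dual ℝ E :=
    { toFun := fun u => (g u : E →ₗ[ℝ] ℝ)
      map_add' := fun u v => by ext; simp
      map_smul' := fun c u => by ext; simp }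
  have hG : Function.Injective G := by
    rw [← LinearMap.ker_eq_bot, LinearMap.ker_eq_bot']
    exact fun u hu => hn u fun v => LinearMap.congr_fun hu v
  let e : E ≃ₗ[ℝ] Module.Dual ℝ E :=
    LinearEquiv.ofInjectiveOfFinrankEq G hG Subspace.dual_finrank_eq.symm
  -- The isomorphism `E ≃ E*` given by `g` conjugates `A` into minus its transpose, so the trace
  -- equals its own negative.
  have he : e.conj (A : E →ₗ[ℝ] E) = (-1 : ℝ) • Module.Dual.transpose (R := ℝ) (A : E →ₗ[ℝ] E) := by
    ext φ v
    obtain ⟨u, rfl⟩ := e.surjective φ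
    simp only [LinearEquiv.conj_apply_apply, LinearEquiv.symm_apply_apply]
    exact (hA u v).trans (neg_one_mul _).symm
  have h1 := LinearMap.trace_conj' (A : E →ₗ[ℝ] E) e
  rw [he, map_smul, LinearMap.trace_transpose', smul_eq_mul] at h1
  linarith

/-- By the Bianchi identity the two endomorphisms differ by `T v w`, which is skew for `g` and so
has trace zero. -/
lemma IsAlgebraicCurvature.trace_ricciMap_symm (h : IsAlgebraicCurvature g T)
    (hn : ∀ u, (∀ v, g u v = 0) → u = 0) (v w : E) :
    LinearMap.trace ℝ E (ricciMap T v w) = LinearMap.trace ℝ E (ricciMap T w v) := by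
  have h1 : ricciMap T v w = ricciMap T w v - T v w := by
    ext u
    have := h.bianchi u v w
    rw [h.swap u w] at this
    rw [sub_apply, ricciMap_apply, ricciMap_apply, eq_sub_iff_add_eq, ← sub_eq_zero, ← this]
    abel
  rw [h1, ContinuousLinearMap.toLinearMap_sub, map_sub, trace_eq_zero_of_skew hn (h.skew v w),
    sub_zero]

section Commute

variable {f : E →L[ℝ] E} {ζ : E} {θ : E →L[ℝ] ℝ} {r e : ℝ}

-- Here `T(u, f v)(f w) = -f T(f u, v) w`. Moving `f` cyclically under the trace gives `-T(f² u, v)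
-- w = r T(u, v) w`, because `T` vanishes when its first argument is `ζ`.
omit [FiniteDimensional ℝ E] in
lemma trace_ricciMap_of_commute (h : IsAlgebraicCurvature g T)
    (hL : LinearStructure g f ζ θ r e) (hf : ∀ u v w, T u v (f w) = f (T u v w))
    (hζ : ∀ u v, T u v ζ = 0) (v w : E) :
    LinearMap.trace ℝ E (ricciMap T (f v) (f w)) = r * LinearMap.trace ℝ E (ricciMap T v w) := by
  have T_ζ : ∀ v w, T ζ v w = 0 := fun v w => hL.nondegenerate _ fun z => by
    rw [h.pair_symm hL.symm, hζ, g.map_zero₂]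
  have h1 : ricciMap T (f v) (f w) = f ∘L (-ricciMap T v w ∘L f) := by
    ext u
    have h1 := h.apply_left_of_commute hL hf u v w
    rw [ricciMap_apply, hf, ← neg_eq_iff_eq_neg.2 h1]
    rfl
  have h2 : (-ricciMap T v w ∘L f) ∘L f = r • ricciMap T v w := by
    ext u
    have h3 : ricciMap T v w ζ = 0 := T_ζ v w
    change -ricciMap T v w (f (f u)) = r • ricciMap T v w u
    rw [hL.φ_φ, (ricciMap T v w).map_neg, (ricciMap T v w).map_smul, (ricciMap T v w).map_sub,
      (ricciMap T v w).map_smul, h3, smul_zero, sub_zero, neg_neg]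
  rw [h1, trace_comp_comm, h2, ContinuousLinearMap.toLinearMap_smul, map_smul, smul_eq_mul]

/-- The trace for `(v, f² w)` is computed in two ways. The formula for `f²` gives `-r Ric(v, w)`;
the Bianchi identity gives `-tr(f T(v, f w)) + Ric(f w, f v)`, which is `r Ric(v, w)` when the
traces `htr` vanish. -/
lemma trace_ricciMap_eq_zero_of_commute (h : IsAlgebraicCurvature g T)
    (hL : LinearStructure g f ζ θ r e) (hf : ∀ u v w, T u v (f w) = f (T u v w))
    (hζ : ∀ u v, T u v ζ = 0)
    (htr : ∀ u v, LinearMap.trace ℝ E (f ∘L T u v : E →L[ℝ] E) = 0) (v w : E) :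
    LinearMap.trace ℝ E (ricciMap T v w) = 0 := by
  have h1 : ricciMap T v (f (f w)) = -(r • ricciMap T v w) := by
    ext u
    change T u v (f (f w)) = -(r • T u v w)
    rw [hL.φ_φ, (T u v).map_neg, (T u v).map_smul, (T u v).map_sub, (T u v).map_smul, hζ,
      smul_zero, sub_zero]
  have h2 : ricciMap T v (f (f w)) = -(f ∘L T v (f w)) + ricciMap T (f w) (f v) := by
    ext u
    change T u v (f (f w)) = -f (T v (f w) u) + T u (f w) (f v)
    have := congrArg f (h.bianchi u v (f w))
    rw [h.swap u (f w) v, f.map_add, f.map_add, f.map_neg, f.map_zero] at this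
    rw [hf u v, hf u (f w), ← sub_eq_zero, ← this]
    abel
  have h3 := congrArg (fun B : E →L[ℝ] E => LinearMap.trace ℝ E (B : E →ₗ[ℝ] E)) (h1.symm.trans h2)
  simp only [ContinuousLinearMap.toLinearMap_neg, ContinuousLinearMap.toLinearMap_smul,
    ContinuousLinearMap.toLinearMap_add, map_neg, map_smul, map_add, htr, neg_zero, zero_add,
    smul_eq_mul, trace_ricciMap_of_commute h hL hf hζ,
    h.trace_ricciMap_symm hL.nondegenerate w v] at h3
  have h4 : r * LinearMap.trace ℝ E (ricciMap T v w) = 0 := by linarith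
  exact (mul_eq_zero.1 h4).resolve_left hL.r_ne_zero

end Commute

/-- The Ricci tensor of an algebraic curvature tensor which is compatible with a mixed
3-structure vanishes. -/
theorem trace_ricciMap_eq_zero {r e a b s : ℝ} (hs : s ≠ 0) (h : IsAlgebraicCurvature g T)
    (hL : LinearStructure g (φ 2) (ξ 2) (η 2) r e)
    (h₁ : ∀ v, φ 0 (φ 1 v) - (a * η 1 v) • ξ 0 = s • φ 2 v)
    (h₂ : ∀ v, -φ 1 (φ 0 v) + (b * η 0 v) • ξ 1 = s • φ 2 v)
    (hξ : ∀ i u v, T u v (ξ i) = 0) (hφ : ∀ i u v w, T u v (φ i w) = φ i (T u v w)) (v w : E) :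
    LinearMap.trace ℝ E (ricciMap T v w) = 0 :=
  trace_ricciMap_eq_zero_of_commute h hL (hφ 2) (hξ 2) (fun u v =>
    trace_comp_φ_eq_zero hs h₁ h₂ (fun i => hξ i u v) (fun i w => hφ i u v w)) v w

end AlgebraicCurvature

/-! ### Curvature of a torsion-free connection in coordinates, and the Ricci identities. -/

section Connection

variable {E : Type*} [NormedAddCommGroup E] [NormedSpace ℝ E]

/-- The curvature `∂_u Γ_v - ∂_v Γ_u + [Γ_u, Γ_v]` of the connection with Christoffel symbols
`Γ`. -/
noncomputable def connectionCurvature (Γ : E → E →L[ℝ] E →L[ℝ] E) (y : E) :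
    E →L[ℝ] E →L[ℝ] E →L[ℝ] E :=
  fderiv ℝ Γ y - (fderiv ℝ Γ y).flip
    + (ContinuousLinearMap.compL ℝ E E E).bilinearComp (Γ y) (Γ y)
    - ((ContinuousLinearMap.compL ℝ E E E).bilinearComp (Γ y) (Γ y)).flip

variable {Γ : E → E →L[ℝ] E →L[ℝ] E} {y : E}

lemma connectionCurvature_apply (u v w : E) :
    connectionCurvature Γ y u v w = fderiv ℝ Γ y u v w - fderiv ℝ Γ y v u w
      + Γ y u (Γ y v w) - Γ y v (Γ y u w) := rfl

lemma fderiv_clm_apply₂ {F H K : Type*} [NormedAddCommGroup F] [NormedSpace ℝ F]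
    [NormedAddCommGroup H] [NormedSpace ℝ H] [NormedAddCommGroup K] [NormedSpace ℝ K]
    {B : E → F →L[ℝ] H →L[ℝ] K} {X : E → F} {Y : E → H}
    (hB : DifferentiableAt ℝ B y) (hX : DifferentiableAt ℝ X y) (hY : DifferentiableAt ℝ Y y)
    (u : E) : fderiv ℝ (fun z => B z (X z) (Y z)) y u
      = fderiv ℝ B y u (X y) (Y y) + B y (fderiv ℝ X y u) (Y y) + B y (X y) (fderiv ℝ Y y u) := by
  rw [fderiv_clm_apply (hB.clm_apply hX) hY, fderiv_clm_apply hB hX]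
  simp only [add_apply, ContinuousLinearMap.comp_apply, ContinuousLinearMap.flip_apply]
  abel

/-- The Ricci identity for vector fields. -/
lemma ricci_identity {V : E → E} {W : E → E → E} (hΓ : DifferentiableAt ℝ Γ y)
    (hV : ContDiffAt ℝ 2 V y)
    (hW : ∀ v, (fun z => W v z) =ᶠ[nhds y] fun z => fderiv ℝ V z v + Γ z v (V z)) (u v : E) :
    fderiv ℝ (W v) y u + Γ y u (W v y) - (fderiv ℝ (W u) y v + Γ y v (W u y))
      = connectionCurvature Γ y u v (V y) := by
  have hV1 : DifferentiableAt ℝ V y := hV.differentiableAt (by norm_num)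
  have hV2 : DifferentiableAt ℝ (fderiv ℝ V) y :=
    (hV.fderiv_right (m := 1) (by norm_num)).differentiableAt (by norm_num)
  have hsymm : fderiv ℝ (fderiv ℝ V) y u v = fderiv ℝ (fderiv ℝ V) y v u :=
    hV.isSymmSndFDerivAt (by simp) u v
  have key : ∀ u v, fderiv ℝ (W v) y u = fderiv ℝ (fderiv ℝ V) y u v + fderiv ℝ Γ y u v (V y)
      + Γ y v (fderiv ℝ V y u) := fun u v => by
    have hc := differentiableAt_const (𝕜 := ℝ) (x := y) v
    rw [(hW v).fderiv_eq, fderiv_fun_add (hV2.clm_apply hc) ((hΓ.clm_apply hc).clm_apply hV1),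
      add_apply, fderiv_clm_apply₂ hΓ hc hV1, fderiv_clm_apply hV2 hc]
    simp
    abel
  rw [key, key, (hW v).eq_of_nhds, (hW u).eq_of_nhds, connectionCurvature_apply, hsymm,
    map_add, map_add]
  abel

/-- The Ricci identity for fields of endomorphisms. -/
lemma ricci_identity_endomorphism {f : E → E →L[ℝ] E} {C : E → E → E → E}
    (hΓ : ContDiffAt ℝ 1 Γ y) (hs : ∀ u v, Γ y u v = Γ y v u) (hf : ContDiffAt ℝ 2 f y)
    (hC : ∀ v w, (fun z => C v w z) =ᶠ[nhds y]
      fun z => fderiv ℝ f z v w + Γ z v (f z w) - f z (Γ z v w)) (u v w : E) :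
    connectionCurvature Γ y u v (f y w) - f y (connectionCurvature Γ y u v w)
      = (fderiv ℝ (C v w) y u + Γ y u (C v w y) - C v (Γ y u w) y - C (Γ y u v) w y)
        - (fderiv ℝ (C u w) y v + Γ y v (C u w y) - C u (Γ y v w) y - C (Γ y v u) w y) := by
  have hc : ∀ w : E, DifferentiableAt ℝ (fun _ : E => w) y := fun w => differentiableAt_const w
  have hf1 : DifferentiableAt ℝ f y := hf.differentiableAt (by norm_num)
  have hf2 : DifferentiableAt ℝ (fderiv ℝ f) y :=
    (hf.fderiv_right (m := 1) (by norm_num)).differentiableAt (by norm_num)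
  have hΓ1 : DifferentiableAt ℝ Γ y := hΓ.differentiableAt (by norm_num)
  have hsymm : fderiv ℝ (fderiv ℝ f) y u v = fderiv ℝ (fderiv ℝ f) y v u :=
    hf.isSymmSndFDerivAt (by simp) u v
  have key : ∀ u v, fderiv ℝ (C v w) y u = fderiv ℝ (fderiv ℝ f) y u v w
      + (fderiv ℝ Γ y u v (f y w) + Γ y v (fderiv ℝ f y u w))
      - (fderiv ℝ f y u (Γ y v w) + f y (fderiv ℝ Γ y u v w)) := fun u v => by
    have hfw := hf1.clm_apply (hc w)
    have hΓvw := (hΓ1.clm_apply (hc v)).clm_apply (hc w)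
    rw [(hC v w).fderiv_eq, fderiv_fun_sub, fderiv_fun_add, sub_apply, add_apply,
      fderiv_clm_apply₂ hf2 (hc v) (hc w), fderiv_clm_apply₂ hΓ1 (hc v) hfw,
      fderiv_clm_apply hf1 hΓvw, fderiv_clm_apply hf1 (hc w), add_apply,
      ContinuousLinearMap.comp_apply]
    · have h3 := fderiv_clm_apply₂ hΓ1 (hc v) (hc w) u
      simp only [fderiv_const_apply, zero_apply, map_zero, add_zero] at h3
      simp [h3]
      abel
    · exact (hf2.clm_apply (hc v)).clm_apply (hc w)
    · exact (hΓ1.clm_apply (hc v)).clm_apply hfw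
    · exact ((hf2.clm_apply (hc v)).clm_apply (hc w)).add ((hΓ1.clm_apply (hc v)).clm_apply hfw)
    · exact hf1.clm_apply hΓvw
  have hCy : ∀ v w, C v w y = fderiv ℝ f y v w + Γ y v (f y w) - f y (Γ y v w) :=
    fun v w => (hC v w).eq_of_nhds
  -- Torsion-freeness cancels the terms `C (Γ y u v) w`. They are kept in the statement so that each
  -- bracket is a full second covariant derivative of `f`.
  rw [key, key, hs v u]
  simp only [hCy, connectionCurvature_apply, hsymm, map_add, map_sub]
  abel

lemma connectionCurvature_swap (u v w : E) :
    connectionCurvature Γ y v u w = -connectionCurvature Γ y u v w := by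
  simp only [connectionCurvature_apply]
  abel

lemma connectionCurvature_bianchi (hΓ : DifferentiableAt ℝ Γ y)
    (hs : ∀ᶠ z in nhds y, ∀ u v, Γ z u v = Γ z v u) (u v w : E) :
    connectionCurvature Γ y u v w + connectionCurvature Γ y v w u
      + connectionCurvature Γ y w u v = 0 := by
  have hd : ∀ u v w, fderiv ℝ Γ y u v w = fderiv ℝ Γ y u w v := fun u v w => by
    have h1 : (fun z => Γ z v w) =ᶠ[nhds y] fun z => Γ z w v := by
      filter_upwards [hs] with z hz using hz v w
    have h2 := congrArg (fun L : E →L[ℝ] E => L u) h1.fderiv_eq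
    have hc : ∀ w : E, DifferentiableAt ℝ (fun _ : E => w) y := fun w => differentiableAt_const w
    simpa [fderiv_clm_apply₂ hΓ (hc _) (hc _)] using h2
  simp only [connectionCurvature_apply]
  rw [hd u w v, hd v u w, hd w v u, hs.self_of_nhds w u, hs.self_of_nhds w v,
    hs.self_of_nhds v u]
  abel

/-- The second derivative of `z ↦ G z w x` is symmetric. Expanding it twice by metric compatibility
leaves exactly the two curvature terms in its antisymmetric part. -/
lemma connectionCurvature_skew {G : E → E →L[ℝ] E →L[ℝ] ℝ} (hΓ : DifferentiableAt ℝ Γ y)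
    (hG : ContDiffAt ℝ 2 G y)
    (hm : ∀ᶠ z in nhds y, ∀ u v w, fderiv ℝ G z u v w = G z (Γ z u v) w + G z v (Γ z u w))
    (u v w x : E) :
    G y (connectionCurvature Γ y u v w) x = -G y w (connectionCurvature Γ y u v x) := by
  have hc : ∀ w : E, DifferentiableAt ℝ (fun _ : E => w) y := fun w => differentiableAt_const w
  have hG1 : DifferentiableAt ℝ G y := hG.differentiableAt (by norm_num)
  let s : E → ℝ := fun z => G z w x
  have hs : ContDiffAt ℝ 2 s y := (hG.clm_apply contDiffAt_const).clm_apply contDiffAt_const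
  have hs2 : DifferentiableAt ℝ (fderiv ℝ s) y :=
    (hs.fderiv_right (m := 1) (by norm_num)).differentiableAt (by norm_num)
  have hsymm : fderiv ℝ (fderiv ℝ s) y u v = fderiv ℝ (fderiv ℝ s) y v u :=
    hs.isSymmSndFDerivAt (by simp) u v
  have hd : ∀ᶠ z in nhds y, DifferentiableAt ℝ G z :=
    ((hG.of_le (m := 1) (by norm_num)).eventually (by simp)).mono fun z hz =>
      hz.differentiableAt (by norm_num)
  have key : ∀ u v, fderiv ℝ (fderiv ℝ s) y u v
      = fderiv ℝ G y u (Γ y v w) x + G y (fderiv ℝ Γ y u v w) x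
        + (fderiv ℝ G y u w (Γ y v x) + G y w (fderiv ℝ Γ y u v x)) := fun u v => by
    have hw : ∀ w, DifferentiableAt ℝ (fun z => Γ z v w) y :=
      fun w => (hΓ.clm_apply (hc v)).clm_apply (hc w)
    have h1 : (fun z => fderiv ℝ s z v) =ᶠ[nhds y]
        fun z => G z (Γ z v w) x + G z w (Γ z v x) := by
      filter_upwards [hm, hd] with z hz hz'
      rw [← hz v w x, fderiv_clm_apply₂ hz' (differentiableAt_const w) (differentiableAt_const x)]
      simp
    have h2 := congrArg (fun L : E →L[ℝ] ℝ => L u) h1.fderiv_eq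
    rw [fderiv_clm_apply hs2 (hc v), fderiv_fun_add ((hG1.clm_apply (hw w)).clm_apply (hc x))
      ((hG1.clm_apply (hc w)).clm_apply (hw x)), add_apply, add_apply, fderiv_clm_apply₂ hG1 (hw w) (hc x),
      fderiv_clm_apply₂ hG1 (hc w) (hw x), fderiv_clm_apply₂ hΓ (hc v) (hc w),
      fderiv_clm_apply₂ hΓ (hc v) (hc x)] at h2
    simpa using h2
  have h1 := key u v
  rw [hsymm, key v u] at h1
  have hm' := hm.self_of_nhds
  simp only [hm'] at h1
  simp only [connectionCurvature_apply, map_add, map_sub, add_apply, sub_apply]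
  linarith

end Connection

/-! ### The Levi-Civita connection, Ricci tensor and scalar curvature of a metric in a chart. -/

section Metric

variable {E : Type*} [NormedAddCommGroup E] [NormedSpace ℝ E]

noncomputable local instance : NormedAddCommGroup (E →L[ℝ] E →L[ℝ] ℝ) :=
  ContinuousLinearMap.toNormedAddCommGroup

noncomputable local instance : NormedSpace ℝ (E →L[ℝ] E →L[ℝ] ℝ) :=
  ContinuousLinearMap.toNormedSpace

set_option synthInstance.maxHeartbeats 400000 in
/-- The Christoffel symbols as a bilinear map. -/
noncomputable def christoffelMap (G : E → E →L[ℝ] E →L[ℝ] ℝ) (y : E) : E →L[ℝ] E →L[ℝ] E :=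
  (ContinuousLinearMap.compL ℝ E (E →L[ℝ] ℝ) E (G y).inverse).comp
    ((1 / 2 : ℝ) • (fderiv ℝ G y + (fderiv ℝ G y).flip
      - ((ContinuousLinearMap.flipₗᵢ ℝ E E ℝ).toContinuousLinearEquiv :
          (E →L[ℝ] E →L[ℝ] ℝ) →L[ℝ] E →L[ℝ] E →L[ℝ] ℝ).comp (fderiv ℝ G y).flip))

@[simp] lemma christoffelMap_apply (G : E → E →L[ℝ] E →L[ℝ] ℝ) (y u v : E) :
    christoffelMap G y u v = christoffel G y u v := rfl

lemma isInvertible_of_nondegenerate [FiniteDimensional ℝ E] {g : E →L[ℝ] E →L[ℝ] ℝ}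
    (hg : ∀ u, (∀ v, g u v = 0) → u = 0) : g.IsInvertible := by
  have hinj : Function.Injective (g : E →ₗ[ℝ] E →L[ℝ] ℝ) := by
    rw [← LinearMap.ker_eq_bot, LinearMap.ker_eq_bot']
    exact fun u hu => hg u fun v => congrArg (fun L : E →L[ℝ] ℝ => L v) hu
  have hdim : Module.finrank ℝ E = Module.finrank ℝ (E →L[ℝ] ℝ) := by
    rw [← (LinearMap.toContinuousLinearMap : (E →ₗ[ℝ] ℝ) ≃ₗ[ℝ] E →L[ℝ] ℝ).finrank_eq]
    exact Subspace.dual_finrank_eq.symm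
  exact ⟨(LinearEquiv.ofInjectiveOfFinrankEq _ hinj hdim).toContinuousLinearEquiv, rfl⟩

lemma apply_inverse {g : E →L[ℝ] E →L[ℝ] ℝ} (hg : g.IsInvertible) (α : E →L[ℝ] ℝ) :
    g (g.inverse α) = α := by
  obtain ⟨e, rfl⟩ := hg
  simp

/-- `G` is a smooth metric on the open set `O`. -/
structure IsMetricOn (G : E → E →L[ℝ] E →L[ℝ] ℝ) (O : Set E) : Prop where
  isOpen : IsOpen O
  contDiffOn : ContDiffOn ℝ ∞ G O
  symm : ∀ y ∈ O, ∀ u v, G y u v = G y v u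
  nondegenerate : ∀ y ∈ O, ∀ u, (∀ v, G y u v = 0) → u = 0

namespace IsMetricOn

variable {G : E → E →L[ℝ] E →L[ℝ] ℝ} {O : Set E} {y : E}

lemma contDiffAt (h : IsMetricOn G O) (hy : y ∈ O) : ContDiffAt ℝ ∞ G y :=
  h.contDiffOn.contDiffAt (h.isOpen.mem_nhds hy)

lemma differentiableAt (h : IsMetricOn G O) (hy : y ∈ O) : DifferentiableAt ℝ G y :=
  (h.contDiffAt hy).differentiableAt (by simp)

lemma fderiv_symm (h : IsMetricOn G O) (hy : y ∈ O) (u v w : E) :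
    fderiv ℝ G y u v w = fderiv ℝ G y u w v := by
  have h1 : (fun z => G z v w) =ᶠ[nhds y] fun z => G z w v := by
    filter_upwards [h.isOpen.mem_nhds hy] with z hz using h.symm z hz v w
  have h2 := congrArg (fun L : E →L[ℝ] ℝ => L u) h1.fderiv_eq
  have hc : ∀ w : E, DifferentiableAt ℝ (fun _ : E => w) y := fun w => differentiableAt_const w
  simpa [fderiv_clm_apply₂ (h.differentiableAt hy) (hc _) (hc _)] using h2

variable [FiniteDimensional ℝ E]

lemma apply_christoffel (h : IsMetricOn G O) (hy : y ∈ O) (u v w : E) :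
    G y (christoffel G y u v) w
      = 1 / 2 * (fderiv ℝ G y u v w + fderiv ℝ G y v u w - fderiv ℝ G y w u v) := by
  rw [christoffel, apply_inverse (isInvertible_of_nondegenerate (h.nondegenerate y hy))]
  rfl

lemma christoffel_symm (h : IsMetricOn G O) (hy : y ∈ O) (u v : E) :
    christoffel G y u v = christoffel G y v u := by
  rw [← sub_eq_zero]
  refine h.nondegenerate y hy _ fun w => ?_
  rw [(G y).map_sub₂, h.apply_christoffel hy, h.apply_christoffel hy, h.fderiv_symm hy w u v]
  ring

/-- The Levi-Civita connection is metric. -/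
lemma fderiv_eq (h : IsMetricOn G O) (hy : y ∈ O) (u v w : E) :
    fderiv ℝ G y u v w = G y (christoffel G y u v) w + G y v (christoffel G y u w) := by
  rw [h.symm y hy v, h.apply_christoffel hy, h.apply_christoffel hy, h.fderiv_symm hy u w v,
    h.fderiv_symm hy w u v, h.fderiv_symm hy v u w]
  ring

lemma contDiffOn_christoffelMap (h : IsMetricOn G O) : ContDiffOn ℝ ∞ (christoffelMap G) O := by
  refine contDiffOn_clm_apply.2 fun u => contDiffOn_clm_apply.2 fun v => ?_
  have hd : ContDiffOn ℝ ∞ (fderiv ℝ G) O :=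
    h.contDiffOn.fderiv_of_isOpen h.isOpen (by simp)
  have hi : ContDiffOn ℝ ∞ (fun y => (G y).inverse) O := fun y hy =>
    ((isInvertible_of_nondegenerate (h.nondegenerate y hy)).contDiffAt_map_inverse.comp y
      (h.contDiffAt hy)).contDiffWithinAt
  change ContDiffOn ℝ ∞ (fun y => (G y).inverse ((1 / 2 : ℝ) •
    (fderiv ℝ G y u v + fderiv ℝ G y v u - ((fderiv ℝ G y).flip u).flip v))) O
  refine hi.clm_apply (ContDiffOn.const_smul (1 / 2 : ℝ) ((ContDiffOn.add ?_ ?_).sub ?_))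
  · exact (hd.clm_apply contDiffOn_const).clm_apply contDiffOn_const
  · exact (hd.clm_apply contDiffOn_const).clm_apply contDiffOn_const
  · exact contDiffOn_clm_apply.2 fun w =>
      ((hd.clm_apply contDiffOn_const).clm_apply contDiffOn_const).clm_apply contDiffOn_const

lemma contDiffAt_christoffelMap (h : IsMetricOn G O) (hy : y ∈ O) :
    ContDiffAt ℝ ∞ (christoffelMap G) y :=
  h.contDiffOn_christoffelMap.contDiffAt (h.isOpen.mem_nhds hy)

lemma differentiableAt_christoffelMap (h : IsMetricOn G O) (hy : y ∈ O) :
    DifferentiableAt ℝ (christoffelMap G) y :=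
  (h.contDiffAt_christoffelMap hy).differentiableAt (by simp)

lemma isAlgebraicCurvature (h : IsMetricOn G O) (hy : y ∈ O) :
    IsAlgebraicCurvature (G y) (connectionCurvature (christoffelMap G) y) where
  swap := connectionCurvature_swap
  bianchi := connectionCurvature_bianchi (h.differentiableAt_christoffelMap hy) <| by
    filter_upwards [h.isOpen.mem_nhds hy] with z hz using fun u v => h.christoffel_symm hz u v
  skew := connectionCurvature_skew (h.differentiableAt_christoffelMap hy)
    ((h.contDiffAt hy).of_le ENat.LEInfty.out) <| by
      filter_upwards [h.isOpen.mem_nhds hy] with z hz using fun u v w => h.fderiv_eq hz u v w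

/-- Constant fields commute and have zero derivative, so only Christoffel terms survive. -/
lemma curvature_const (h : IsMetricOn G O) (hy : y ∈ O) (u v w : E) :
    curvature G (fun _ => u) (fun _ => v) (fun _ => w) y
      = connectionCurvature (christoffelMap G) y u v w := by
  have hc : ∀ w : E, DifferentiableAt ℝ (fun _ : E => w) y := fun w => differentiableAt_const w
  have hL : ∀ u v : E, leviCivita G (fun _ => u) (fun _ => v)
      = fun z => christoffelMap G z u v := fun u v => by
    ext z; simp [leviCivita]
  have h0 : leviCivita G (VectorField.lieBracket ℝ (fun _ => u) fun _ => v) (fun _ => w) y = 0 := by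
    have : VectorField.lieBracket ℝ (fun _ => u) (fun _ => v) y = 0 := by
      simp [VectorField.lieBracket]
    simp only [leviCivita, this]
    rw [← christoffelMap_apply]
    simp
  rw [curvature, h0, hL, hL]
  simp only [leviCivita, ← christoffelMap_apply]
  rw [fderiv_clm_apply₂ (h.differentiableAt_christoffelMap hy) (hc _) (hc _),
    fderiv_clm_apply₂ (h.differentiableAt_christoffelMap hy) (hc _) (hc _),
    connectionCurvature_apply]
  simp [-christoffelMap_apply]
  abel

lemma ricci_eq_trace (h : IsMetricOn G O) (hy : y ∈ O) (v w : E) :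
    ricci G y v w
      = LinearMap.trace ℝ E (ricciMap (connectionCurvature (christoffelMap G) y) v w) := by
  rw [LinearMap.trace_eq_matrix_trace ℝ (Module.finBasis ℝ E), Matrix.trace, ricci]
  refine Finset.sum_congr rfl fun i _ => ?_
  rw [h.curvature_const hy, Matrix.diag_apply, LinearMap.toMatrix_apply]
  rfl

/-- If the Ricci tensor is `c` times the metric, then the scalar curvature is `c` times the
dimension. -/
lemma scalar_eq (h : IsMetricOn G O) (hy : y ∈ O) {c : ℝ}
    (hR : ∀ v w, ricci G y v w = c * G y v w) :
    scalar G y = c * Module.finrank ℝ E := by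
  simp only [scalar, hR]
  -- By symmetry of `G y`, this is the `i`-th coordinate of the `i`-th basis vector.
  have : ∀ i, G y (Module.finBasis ℝ E i) ((G y).inverse
      (LinearMap.toContinuousLinearMap ((Module.finBasis ℝ E).coord i))) = 1 := fun i => by
    rw [h.symm y hy, apply_inverse (isInvertible_of_nondegenerate (h.nondegenerate y hy))]
    simp
  simp [this, mul_comm]

end IsMetricOn

end Metric

/-! ### (Para)Sasakian structures on an open subset of a vector space. -/

section LocalSasakian

variable {E : Type*} [NormedAddCommGroup E] [NormedSpace ℝ E]

/-- The coordinate expression of a (para)Sasakian structure on an open subset of a vector space. -/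
structure IsSasakianOn (G : E → E →L[ℝ] E →L[ℝ] ℝ) (φ : E → E →L[ℝ] E) (ξ : E → E)
    (η : E → E →L[ℝ] ℝ) (r ε : ℝ) (O : Set E) : Prop extends IsMetricOn G O where
  contDiffOn_φ : ContDiffOn ℝ ∞ φ O
  contDiffOn_ξ : ContDiffOn ℝ ∞ ξ O
  contDiffOn_η : ContDiffOn ℝ ∞ η O
  linear : ∀ y ∈ O, LinearStructure (G y) (φ y) (ξ y) (η y) r ε
  contact : ∀ y ∈ O, ∀ u v, fderiv ℝ η y u v - fderiv ℝ η y v u = 2 * G y u (φ y v)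
  normal : ∀ y ∈ O, ∀ v w, fderiv ℝ φ y (φ y v) w - fderiv ℝ φ y (φ y w) v
    + φ y (fderiv ℝ φ y w v) - φ y (fderiv ℝ φ y v w) + (2 * r * G y v (φ y w)) • ξ y = 0

namespace IsSasakianOn

variable {G : E → E →L[ℝ] E →L[ℝ] ℝ} {φ : E → E →L[ℝ] E} {ξ : E → E}
    {η : E → E →L[ℝ] ℝ} {r ε : ℝ} {O : Set E} {y : E}

lemma contDiffAt_φ (h : IsSasakianOn G φ ξ η r ε O) (hy : y ∈ O) : ContDiffAt ℝ ∞ φ y :=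
  h.contDiffOn_φ.contDiffAt (h.isOpen.mem_nhds hy)

lemma contDiffAt_ξ (h : IsSasakianOn G φ ξ η r ε O) (hy : y ∈ O) : ContDiffAt ℝ ∞ ξ y :=
  h.contDiffOn_ξ.contDiffAt (h.isOpen.mem_nhds hy)

lemma contDiffAt_η (h : IsSasakianOn G φ ξ η r ε O) (hy : y ∈ O) : ContDiffAt ℝ ∞ η y :=
  h.contDiffOn_η.contDiffAt (h.isOpen.mem_nhds hy)

lemma differentiableAt_φ (h : IsSasakianOn G φ ξ η r ε O) (hy : y ∈ O) :
    DifferentiableAt ℝ φ y :=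
  (h.contDiffAt_φ hy).differentiableAt (by simp)

lemma differentiableAt_ξ (h : IsSasakianOn G φ ξ η r ε O) (hy : y ∈ O) :
    DifferentiableAt ℝ ξ y :=
  (h.contDiffAt_ξ hy).differentiableAt (by simp)

lemma differentiableAt_η (h : IsSasakianOn G φ ξ η r ε O) (hy : y ∈ O) :
    DifferentiableAt ℝ η y :=
  (h.contDiffAt_η hy).differentiableAt (by simp)

lemma eventually (h : IsSasakianOn G φ ξ η r ε O) (hy : y ∈ O) {p : E → Prop}
    (H : ∀ z ∈ O, p z) : ∀ᶠ z in nhds y, p z := by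
  filter_upwards [h.isOpen.mem_nhds hy] with z hz using H z hz

/-- Pointwise relations on the open set `O` may be differentiated; this turns the algebraic
relations of the structure into relations for `∇φ` and `∇ξ`. -/
lemma fderiv_eq_of_eqOn {F : Type*} [NormedAddCommGroup F] [NormedSpace ℝ F]
    (h : IsSasakianOn G φ ξ η r ε O) (hy : y ∈ O) {f f' : E → F} (H : ∀ z ∈ O, f z = f' z) (u : E) :
    fderiv ℝ f y u = fderiv ℝ f' y u := by
  rw [Filter.EventuallyEq.fderiv_eq (h.eventually hy H)]

/-- The closedness of the fundamental form. -/
lemma fderiv_cyclic (h : IsSasakianOn G φ ξ η r ε O) (hy : y ∈ O) (u v w : E) :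
    fderiv ℝ (fun z => G z v (φ z w)) y u + fderiv ℝ (fun z => G z w (φ z u)) y v
      + fderiv ℝ (fun z => G z u (φ z v)) y w = 0 := by
  have hc : ∀ w : E, DifferentiableAt ℝ (fun _ : E => w) y := fun w => differentiableAt_const w
  have hη : ContDiffAt ℝ 2 η y := (h.contDiffAt_η hy).of_le ENat.LEInfty.out
  have hη2 : DifferentiableAt ℝ (fderiv ℝ η) y :=
    (hη.fderiv_right (m := 1) (by norm_num)).differentiableAt (by norm_num)
  have hsymm : ∀ u v, fderiv ℝ (fderiv ℝ η) y u v = fderiv ℝ (fderiv ℝ η) y v u :=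
    fun u v => hη.isSymmSndFDerivAt (by simp) u v
  -- The form is `dη`, so its closedness is `d²η = 0`, the symmetry of the second derivative of `η`.
  have key : ∀ u v w, 2 * fderiv ℝ (fun z => G z v (φ z w)) y u
      = fderiv ℝ (fderiv ℝ η) y u v w - fderiv ℝ (fderiv ℝ η) y u w v := fun u v w => by
    have h1 := h.fderiv_eq_of_eqOn hy (fun z hz => h.contact z hz v w) u
    rw [fderiv_fun_sub ((hη2.clm_apply (hc v)).clm_apply (hc w))
      ((hη2.clm_apply (hc w)).clm_apply (hc v)), sub_apply, fderiv_clm_apply₂ hη2 (hc v) (hc w),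
      fderiv_clm_apply₂ hη2 (hc w) (hc v), fderiv_const_mul
      (((h.differentiableAt hy).clm_apply (hc v)).clm_apply
        ((h.differentiableAt_φ hy).clm_apply (hc w)))] at h1
    simpa using h1.symm
  have h1 := key u v w
  have h2 := key v w u
  have h3 := key w u v
  rw [hsymm v u] at h2
  rw [hsymm w u, hsymm w v] at h3
  linarith

variable [FiniteDimensional ℝ E]

/-- The covariant derivative `u ↦ ∇_u ξ`. -/
noncomputable def _root_.MixedThreeSasakian.covariantVector (G : E → E →L[ℝ] E →L[ℝ] ℝ)
    (ξ : E → E) (y : E) : E →L[ℝ] E :=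
  fderiv ℝ ξ y + (christoffelMap G y).flip (ξ y)

/-- The covariant derivative `u ↦ ∇_u φ`. -/
noncomputable def _root_.MixedThreeSasakian.covariantEndomorphism (G : E → E →L[ℝ] E →L[ℝ] ℝ)
    (φ : E → E →L[ℝ] E) (y : E) : E →L[ℝ] E →L[ℝ] E :=
  fderiv ℝ φ y + ((ContinuousLinearMap.compL ℝ E E E).flip (φ y)).comp (christoffelMap G y)
    - (ContinuousLinearMap.compL ℝ E E E (φ y)).comp (christoffelMap G y)

omit [FiniteDimensional ℝ E] in
lemma _root_.MixedThreeSasakian.covariantVector_apply (u : E) :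
    covariantVector G ξ y u = fderiv ℝ ξ y u + christoffelMap G y u (ξ y) := rfl

omit [FiniteDimensional ℝ E] in
lemma _root_.MixedThreeSasakian.covariantEndomorphism_apply (u v : E) :
    covariantEndomorphism G φ y u v = fderiv ℝ φ y u v + christoffelMap G y u (φ y v)
      - φ y (christoffelMap G y u v) := rfl

/-- Differentiating `η = ε g(ξ, ·)` identifies `(∇_u η) v` with `ε g(∇_u ξ, v)`. -/
lemma g_covariantVector (h : IsSasakianOn G φ ξ η r ε O) (hy : y ∈ O) (u v : E) :
    ε * G y (covariantVector G ξ y u) v = fderiv ℝ η y u v - η y (christoffelMap G y u v) := by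
  have hc : ∀ w : E, DifferentiableAt ℝ (fun _ : E => w) y := fun w => differentiableAt_const w
  have h1 := h.fderiv_eq_of_eqOn hy (fun z hz => (h.linear z hz).η_eq v) u
  rw [fderiv_const_mul (((h.differentiableAt hy).clm_apply (h.differentiableAt_ξ hy)).clm_apply
    (hc v)), fderiv_clm_apply (h.differentiableAt_η hy) (hc v), smul_apply,
    fderiv_clm_apply₂ (h.differentiableAt hy) (h.differentiableAt_ξ hy) (hc v),
    h.fderiv_eq hy] at h1
  simp only [fderiv_fun_const, Pi.zero_apply, ContinuousLinearMap.comp_zero, zero_add,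
    ContinuousLinearMap.flip_apply, zero_apply, map_zero, add_zero, smul_eq_mul] at h1
  rw [covariantVector_apply, (G y).map_add₂, (h.linear y hy).η_eq, h1]
  simp only [christoffelMap_apply]
  ring

/-- The pointwise identities satisfied by the covariant derivatives of a (para)Sasakian
structure. -/
lemma linearSasakian (h : IsSasakianOn G φ ξ η r ε O) (hy : y ∈ O) :
    LinearSasakian (G y) (φ y) (ξ y) (η y) r ε (covariantEndomorphism G φ y)
      (covariantVector G ξ y) := by
  have hc : ∀ w : E, DifferentiableAt ℝ (fun _ : E => w) y := fun w => differentiableAt_const w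
  have hG := h.differentiableAt hy
  have hφ := h.differentiableAt_φ hy
  have hξ := h.differentiableAt_ξ hy
  have hη := h.differentiableAt_η hy
  have hL := h.linear y hy
  have hΓ : ∀ u v, christoffelMap G y u v = christoffelMap G y v u :=
    fun u v => h.christoffel_symm hy u v
  have hDG : ∀ u v w, fderiv ℝ G y u v w
      = G y (christoffelMap G y u v) w + G y v (christoffelMap G y u w) :=
    fun u v w => h.fderiv_eq hy u v w
  have hDφ : ∀ u w, fderiv ℝ (fun z => φ z w) y u = fderiv ℝ φ y u w := fun u w => by
    rw [fderiv_clm_apply hφ (hc w)]; simp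
  have skew : ∀ u v w, G y (covariantEndomorphism G φ y u v) w
      = -G y v (covariantEndomorphism G φ y u w) := fun u v w => by
    have h1 := h.fderiv_eq_of_eqOn hy (fun z hz => (h.linear z hz).g_φ v w) u
    rw [fderiv_fun_neg, neg_apply, fderiv_clm_apply₂ hG (hφ.clm_apply (hc v)) (hc w),
      fderiv_clm_apply₂ hG (hc v) (hφ.clm_apply (hc w)), hDφ, hDφ, hDG, hDG] at h1
    simp only [fderiv_fun_const, Pi.zero_apply, zero_apply, map_zero, add_zero] at h1
    have h2 := hL.g_φ v (christoffelMap G y u w)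
    have h3 := hL.g_φ (christoffelMap G y u v) w
    simp only [covariantEndomorphism_apply, map_add, map_sub, add_apply, sub_apply]
    linarith
  refine { hL with
    skew := skew
    closed := fun u v w => ?_
    normal := fun v w => ?_
    P_φ := fun u v => ?_
    φ_A := fun u => ?_
    g_A_ξ := fun u => ?_
    contact := fun u v => ?_ }
  · have key : ∀ u v w, fderiv ℝ (fun z => G z v (φ z w)) y u
        = G y v (covariantEndomorphism G φ y u w) + G y (christoffelMap G y u v) (φ y w)
          - G y (christoffelMap G y u w) (φ y v) := fun u v w => by
      rw [fderiv_clm_apply₂ hG (hc v) (hφ.clm_apply (hc w)), hDφ, hDG]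
      have h2 := hL.g_φ v (christoffelMap G y u w)
      have h3 := hL.symm (christoffelMap G y u w) (φ y v)
      simp only [covariantEndomorphism_apply, map_add, map_sub, fderiv_fun_const, Pi.zero_apply,
        zero_apply, map_zero, add_zero]
      linarith
    have h1 := h.fderiv_cyclic hy u v w
    rw [key, key, key, hΓ w u, hΓ v u, hΓ w v] at h1
    rw [skew, skew v, skew w]
    linarith
  -- By symmetry of the Christoffel symbols, `∂` may be replaced by `∇` in the Nijenhuis tensor.
  · rw [← h.normal y hy v w]
    simp only [covariantEndomorphism_apply, map_add, map_sub]
    rw [hΓ (φ y w) (φ y v), hΓ (φ y w) v, hΓ (φ y v) w, hΓ w v]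
    abel
  · have h1 := h.fderiv_eq_of_eqOn hy (fun z hz => (h.linear z hz).φ_φ v) u
    have hηv : DifferentiableAt ℝ (fun z => η z v) y := hη.clm_apply (hc v)
    rw [fderiv_fun_neg, fderiv_fun_const_smul ((hc v).fun_sub (hηv.fun_smul hξ)),
      fderiv_fun_sub (hc v) (hηv.fun_smul hξ), fderiv_fun_smul hηv hξ,
      fderiv_clm_apply hφ (hφ.clm_apply (hc v)), fderiv_clm_apply hη (hc v)] at h1
    simp only [fderiv_fun_const, Pi.zero_apply, add_apply, ContinuousLinearMap.comp_apply,
      ContinuousLinearMap.flip_apply, hDφ, neg_apply, smul_apply,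
      ContinuousLinearMap.comp_zero, zero_add, zero_sub,
      ContinuousLinearMap.smulRight_apply] at h1
    rw [h.g_covariantVector hy, covariantEndomorphism_apply, covariantEndomorphism_apply,
      covariantVector_apply, map_sub, map_add, hL.φ_φ, hL.φ_φ, (christoffelMap G y u).map_neg,
      (christoffelMap G y u).map_smul, (christoffelMap G y u).map_sub,
      (christoffelMap G y u).map_smul]
    rw [← sub_eq_zero] at h1 ⊢
    rw [← h1]
    module
  · have h1 := h.fderiv_eq_of_eqOn hy (fun z hz => (h.linear z hz).φ_ξ) u
    rw [fderiv_clm_apply hφ hξ] at h1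
    simp only [fderiv_fun_const, Pi.zero_apply, add_apply, ContinuousLinearMap.comp_apply,
      ContinuousLinearMap.flip_apply, zero_apply] at h1
    rw [covariantEndomorphism_apply, covariantVector_apply, map_add, hL.φ_ξ, map_zero]
    refine Eq.trans ?_ h1
    abel
  · have h1 := h.fderiv_eq_of_eqOn hy (fun z hz => (h.linear z hz).g_ξ_ξ) u
    rw [fderiv_clm_apply₂ hG hξ hξ, hDG, hL.symm (ξ y), hL.symm (ξ y)] at h1
    simp only [fderiv_fun_const, Pi.zero_apply, zero_apply] at h1
    rw [covariantVector_apply, (G y).map_add₂]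
    linarith
  · rw [mul_sub, h.g_covariantVector hy, h.g_covariantVector hy, hΓ v u, ← h.contact y hy]
    ring

lemma covariantVector_eq (h : IsSasakianOn G φ ξ η r ε O) (hy : y ∈ O) (u : E) :
    fderiv ℝ ξ y u + christoffelMap G y u (ξ y) = -(ε • φ y u) :=
  (h.linearSasakian hy).A_eq u

lemma covariantEndomorphism_eq (h : IsSasakianOn G φ ξ η r ε O) (hy : y ∈ O) (u v : E) :
    fderiv ℝ φ y u v + christoffelMap G y u (φ y v) - φ y (christoffelMap G y u v)
      = r • (G y u v • ξ y - (ε * η y v) • u) :=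
  (h.linearSasakian hy).P_eq u v

/-- As `∇ξ = -ε φ`, the Ricci identity gives `R(u, v) ξ = -ε ((∇_u φ) v - (∇_v φ) u)`. The `ξ` terms
cancel by symmetry of the metric, and `ε² = 1`. -/
lemma curvature_ξ (h : IsSasakianOn G φ ξ η r ε O) (hy : y ∈ O) (u v : E) :
    connectionCurvature (christoffelMap G) y u v (ξ y) = r • (η y v • u - η y u • v) := by
  have hc : ∀ w : E, DifferentiableAt ℝ (fun _ : E => w) y := fun w => differentiableAt_const w
  have hφ := h.differentiableAt_φ hy
  have hL := h.linear y hy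
  have hΓ : christoffelMap G y v u = christoffelMap G y u v := h.christoffel_symm hy v u
  have hd : ∀ u v, fderiv ℝ (fun z => -(ε • φ z v)) y u = -(ε • fderiv ℝ φ y u v) := fun u v => by
    rw [fderiv_fun_neg, fderiv_fun_const_smul (hφ.clm_apply (hc v)), fderiv_clm_apply hφ (hc v)]
    simp
  have h1 := ricci_identity (W := fun v z => -(ε • φ z v)) (h.differentiableAt_christoffelMap hy)
    ((h.contDiffAt_ξ hy).of_le ENat.LEInfty.out)
    (fun v => h.eventually hy fun z hz => (h.covariantVector_eq hz v).symm) u v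
  have h2 := h.covariantEndomorphism_eq hy u v
  have h3 := h.covariantEndomorphism_eq hy v u
  have hε := hL.ε_mul_ε
  rw [← h1]
  simp only [hd, map_neg, map_smul]
  rw [hΓ, hL.symm v u] at h3
  have h4 : r • (η y v • u - η y u • v)
      = -(ε • (r • (G y u v • ξ y - (ε * η y v) • u) - r • (G y u v • ξ y - (ε * η y u) • v))) := by
    have : -(ε • (r • (G y u v • ξ y - (ε * η y v) • u) - r • (G y u v • ξ y - (ε * η y u) • v)))
        = (ε * ε) • r • (η y v • u - η y u • v) := by module
    rw [this, hε, one_smul]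
  rw [h4, ← h2, ← h3]
  module

/-- The formula for `∇φ` is differentiated again with `∇ξ = -ε φ` and `(∇_u η) w = g(u, φ w)`, then
antisymmetrized. The right side is the commutator of `r ε C(u, v)` with `φ`, where `C` is
`constantCurvature`. -/
lemma curvature_φ (h : IsSasakianOn G φ ξ η r ε O) (hy : y ∈ O) (u v w : E) :
    connectionCurvature (christoffelMap G) y u v (φ y w)
        - φ y (connectionCurvature (christoffelMap G) y u v w)
      = (r * ε) • ((G y v (φ y w) • u - G y u (φ y w) • v)
        - φ y (G y v w • u - G y u w • v)) := by
  have hc : ∀ w : E, DifferentiableAt ℝ (fun _ : E => w) y := fun w => differentiableAt_const w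
  have hG := h.differentiableAt hy
  have hξ := h.differentiableAt_ξ hy
  have hη := h.differentiableAt_η hy
  have hL := h.linear y hy
  have hΓ : ∀ u v, christoffelMap G y u v = christoffelMap G y v u :=
    fun u v => h.christoffel_symm hy u v
  have hDG : ∀ u v w, fderiv ℝ G y u v w
      = G y (christoffelMap G y u v) w + G y v (christoffelMap G y u w) :=
    fun u v w => h.fderiv_eq hy u v w
  have hd : ∀ u v, fderiv ℝ (fun z => r • (G z v w • ξ z - (ε * η z w) • v)) y u = r • ((fderiv ℝ G y u v w) • ξ y
      + G y v w • fderiv ℝ ξ y u - (ε * fderiv ℝ η y u w) • v) := fun u v => by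
    have hGvw : DifferentiableAt ℝ (fun z => G z v w) y := (hG.clm_apply (hc v)).clm_apply (hc w)
    have hηw : DifferentiableAt ℝ (fun z => η z w) y := hη.clm_apply (hc w)
    have hηw' : DifferentiableAt ℝ (fun z => ε * η z w) y := hηw.const_mul ε
    have e1 : fderiv ℝ (fun z => G z v w) y u = fderiv ℝ G y u v w := by
      rw [fderiv_clm_apply₂ hG (hc v) (hc w)]; simp
    have e2 : fderiv ℝ (fun z => η z w) y u = fderiv ℝ η y u w := by
      rw [fderiv_clm_apply hη (hc w)]; simp
    rw [fderiv_fun_const_smul ((hGvw.fun_smul hξ).fun_sub (hηw'.fun_smul (hc v))),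
      fderiv_fun_sub (hGvw.fun_smul hξ) (hηw'.fun_smul (hc v)), fderiv_fun_smul hGvw hξ,
      fderiv_fun_smul hηw' (hc v), fderiv_const_mul hηw]
    simp only [smul_apply, sub_apply, add_apply, ContinuousLinearMap.smulRight_apply, e1, e2,
      fderiv_fun_const, Pi.zero_apply, smul_zero, zero_add, smul_eq_mul]
    module
  have h1 := ricci_identity_endomorphism (C := fun v w z => r • (G z v w • ξ z - (ε * η z w) • v))
    ((h.contDiffAt_christoffelMap hy).of_le ENat.LEInfty.out) hΓ
    ((h.contDiffAt_φ hy).of_le ENat.LEInfty.out)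
    (fun v w => h.eventually hy fun z hz => (h.covariantEndomorphism_eq hz v w).symm) u v w
  have h2 : ∀ u, fderiv ℝ ξ y u = -(ε • φ y u) - christoffelMap G y u (ξ y) := fun u =>
    eq_sub_of_add_eq (h.covariantVector_eq hy u)
  have h3 : ∀ u, ε * fderiv ℝ η y u w = ε * η y (christoffelMap G y u w) + ε * G y u (φ y w) :=
    fun u => by
      have e1 := h.g_covariantVector hy u w
      have e2 : covariantVector G ξ y u = -(ε • φ y u) := (h.linearSasakian hy).A_eq u
      rw [e2, (G y).map_neg₂, (G y).map_smul₂, hL.g_φ, smul_eq_mul] at e1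
      linear_combination (-ε) * e1 + ε * G y u (φ y w) * hL.ε_mul_ε
  rw [h1, hd, hd]
  simp only [h2, h3, hDG, map_smul, map_sub]
  rw [hΓ v u]
  module

end IsSasakianOn

end LocalSasakian

/-! ### The Einstein property: comparison with constant curvature. -/

section Einstein

variable {E : Type*} [NormedAddCommGroup E] [NormedSpace ℝ E]

/-- The curvature tensor `g(v, w) u - g(u, w) v` of constant curvature `1`. -/
noncomputable def constantCurvature (g : E →L[ℝ] E →L[ℝ] ℝ) : E →L[ℝ] E →L[ℝ] E →L[ℝ] E :=
  ((ContinuousLinearMap.smulRightL ℝ E E).comp g).flip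
    - (ContinuousLinearMap.smulRightL ℝ E E).comp g

variable {g : E →L[ℝ] E →L[ℝ] ℝ}

lemma constantCurvature_apply (u v w : E) :
    constantCurvature g u v w = g v w • u - g u w • v := rfl

lemma isAlgebraicCurvature_constantCurvature (hg : ∀ u v, g u v = g v u) :
    IsAlgebraicCurvature g (constantCurvature g) where
  swap u v w := by simp only [constantCurvature_apply]; abel
  bianchi u v w := by
    simp only [constantCurvature_apply]
    rw [hg w u, hg w v, hg v u]
    abel
  skew u v w z := by
    simp only [constantCurvature_apply, map_sub, map_smul, sub_apply, smul_apply, smul_eq_mul]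
    rw [hg w u, hg w v]
    ring

set_option synthInstance.maxHeartbeats 400000 in
lemma IsAlgebraicCurvature.sub_smul {T T' : E →L[ℝ] E →L[ℝ] E →L[ℝ] E}
    (h : IsAlgebraicCurvature g T) (h' : IsAlgebraicCurvature g T') (c : ℝ) :
    IsAlgebraicCurvature g (T - c • T') where
  swap u v w := by
    simp only [sub_apply, smul_apply, h.swap u v, h'.swap u v]
    module
  bianchi u v w := by
    have e : ∀ u v w, (T - c • T') u v w = T u v w - c • T' u v w := fun _ _ _ => rfl
    have : (T u v w + T v w u + T w u v) - c • (T' u v w + T' v w u + T' w u v) = 0 := by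
      rw [h.bianchi, h'.bianchi, smul_zero, sub_zero]
    rw [e, e, e, ← this]
    module
  skew u v w z := by
    have e : ∀ u v w, (T - c • T') u v w = T u v w - c • T' u v w := fun _ _ _ => rfl
    rw [e, e, g.map_sub₂, g.map_smul₂, h.skew, h'.skew, (g w).map_sub, (g w).map_smul]
    simp only [smul_eq_mul]
    ring

lemma trace_ricciMap_constantCurvature [FiniteDimensional ℝ E] (v w : E) :
    LinearMap.trace ℝ E (ricciMap (constantCurvature g) v w)
      = (Module.finrank ℝ E - 1) * g v w := by
  have h1 : (ricciMap (constantCurvature g) v w : E →ₗ[ℝ] E)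
      = g v w • LinearMap.id - (g.flip w : E →ₗ[ℝ] ℝ).smulRight v := by
    ext u
    rfl
  rw [h1, map_sub, map_smul, LinearMap.trace_id, LinearMap.trace_smulRight]
  simp
  ring

variable [FiniteDimensional ℝ E]

set_option synthInstance.maxHeartbeats 400000 in
/-- The scalar curvature of a metric which carries a mixed 3-Sasakian structure. -/
theorem scalar_eq_of_isSasakianOn {G : E → E →L[ℝ] E →L[ℝ] ℝ} {φ : Fin 3 → E → E →L[ℝ] E}
    {ξ : Fin 3 → E → E} {η : Fin 3 → E → E →L[ℝ] ℝ} {r ε : Fin 3 → ℝ} {O : Set E} {y : E}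
    {K a b s : ℝ} (h : ∀ i, IsSasakianOn G (φ i) (ξ i) (η i) (r i) (ε i) O) (hy : y ∈ O)
    (hK : ∀ i, r i * ε i = K) (hs : s ≠ 0)
    (h₁ : ∀ v, φ 0 y (φ 1 y v) - (a * η 1 y v) • ξ 0 y = s • φ 2 y v)
    (h₂ : ∀ v, -φ 1 y (φ 0 y v) + (b * η 0 y v) • ξ 1 y = s • φ 2 y v) :
    scalar G y = K * (Module.finrank ℝ E - 1) * Module.finrank ℝ E := by
  have hL := fun i => (h i).linear y hy
  set R := connectionCurvature (christoffelMap G) y with hR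
  have eT : ∀ u v w, (R - K • constantCurvature (G y)) u v w
      = R u v w - K • (G y v w • u - G y u w • v) := fun _ _ _ => rfl
  have hT : IsAlgebraicCurvature (G y) (R - K • constantCurvature (G y)) :=
    ((h 2).isAlgebraicCurvature hy).sub_smul
      (isAlgebraicCurvature_constantCurvature (hL 2).symm) K
  -- One constant `K` serves all three indices, so the difference tensor is compatible with the
  -- whole 3-structure. On `ξ i` the cancellation uses `K ε i = r i`.
  have hT0 : ∀ v w, LinearMap.trace ℝ E (ricciMap (R - K • constantCurvature (G y)) v w) = 0 := by
    refine trace_ricciMap_eq_zero (φ := fun i => φ i y) (ξ := fun i => ξ i y)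
      (η := fun i => η i y) hs hT (hL 2) h₁ h₂ (fun i u v => ?_) (fun i u v w => ?_)
    · have hr : ∀ v, K * (ε i * η i y v) = r i * η i y v := fun v => by
        rw [← hK i]
        linear_combination r i * η i y v * (hL i).ε_mul_ε
      rw [eT, hR, (h i).curvature_ξ hy, (hL i).symm v, (hL i).symm u, (hL i).g_ξ, (hL i).g_ξ,
        smul_sub, smul_sub, smul_smul, smul_smul, smul_smul, smul_smul, hr, hr, sub_self]
    · have h1 := (h i).curvature_φ hy u v w
      rw [hK i, ← hR] at h1
      rw [eT, eT, (φ i y).map_sub, (φ i y).map_smul, sub_eq_sub_iff_sub_eq_sub, h1, smul_sub]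
  refine ((h 2).scalar_eq hy (c := K * (Module.finrank ℝ E - 1)) fun v w => ?_)
  have h3 := hT0 v w
  have h4 : (ricciMap (R - K • constantCurvature (G y)) v w : E →ₗ[ℝ] E)
      = ricciMap R v w - K • (ricciMap (constantCurvature (G y)) v w : E →ₗ[ℝ] E) := rfl
  rw [h4, map_sub, map_smul, trace_ricciMap_constantCurvature, sub_eq_zero] at h3
  rw [(h 2).ricci_eq_trace hy, ← hR, h3, smul_eq_mul, mul_assoc]

end Einstein

/-! ### Coordinate expressions of vector fields, endomorphisms and forms. -/

section Chart

variable {E : Type*} [NormedAddCommGroup E] [NormedSpace ℝ E]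
  {M : Type*} [TopologicalSpace M] [ChartedSpace E M]

/-- The derivative at `y` of the inverse of the preferred chart at `p`. -/
noncomputable def chartFrame (p : M) (y : E) :
    E →L[ℝ] TangentSpace 𝓘(ℝ, E) ((extChartAt 𝓘(ℝ, E) p).symm y) :=
  mfderiv 𝓘(ℝ, E) 𝓘(ℝ, E) (extChartAt 𝓘(ℝ, E) p).symm y

/-- The vector field on `M` with constant coordinates `v` in the preferred chart at `p`. -/
noncomputable def coordinateField (p : M) (v : E) (x : M) : TangentSpace 𝓘(ℝ, E) x :=
  VectorField.mpullback 𝓘(ℝ, E) 𝓘(ℝ, E) (extChartAt 𝓘(ℝ, E) p) (fun _ => v) x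

/-- The coordinate expression of a vector field in the preferred chart at `p`. -/
noncomputable def vectorInChart (X : ∀ x : M, TangentSpace 𝓘(ℝ, E) x) (p : M) (y : E) : E :=
  VectorField.mpullback 𝓘(ℝ, E) 𝓘(ℝ, E) (extChartAt 𝓘(ℝ, E) p).symm X y

/-- The coordinate expression of a field of endomorphisms. -/
noncomputable def endomorphismInChart
    (f : ∀ x : M, TangentSpace 𝓘(ℝ, E) x →L[ℝ] TangentSpace 𝓘(ℝ, E) x) (p : M) (y : E) :
    E →L[ℝ] E :=
  (chartFrame p y).inverse ∘L f _ ∘L chartFrame p y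

/-- The coordinate expression of a `1`-form. -/
noncomputable def formInChart (η : ∀ x : M, TangentSpace 𝓘(ℝ, E) x →L[ℝ] ℝ) (p : M) (y : E) :
    E →L[ℝ] ℝ :=
  η _ ∘L chartFrame p y

variable [IsManifold 𝓘(ℝ, E) ∞ M] {p : M} {y : E}

lemma isManifold_one : IsManifold 𝓘(ℝ, E) 1 M :=
  IsManifold.of_le (n := ∞) (ENat.LEInfty.out)

lemma mfderiv_extChartAt_comp_chartFrame (hy : y ∈ (extChartAt 𝓘(ℝ, E) p).target) (v : E) :
    mfderiv 𝓘(ℝ, E) 𝓘(ℝ, E) (extChartAt 𝓘(ℝ, E) p) ((extChartAt 𝓘(ℝ, E) p).symm y)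
      (chartFrame p y v) = v := by
  have := isManifold_one (E := E) (M := M)
  have h := mfderiv_extChartAt_comp_mfderivWithin_extChartAt_symm (I := 𝓘(ℝ, E)) hy
  rw [modelWithCornersSelf_coe, Set.range_id, mfderivWithin_univ] at h
  exact congrArg (fun L : E →L[ℝ] E => L v) h

lemma isInvertible_chartFrame (hy : y ∈ (extChartAt 𝓘(ℝ, E) p).target) :
    (chartFrame p y).IsInvertible := by
  have := isManifold_one (E := E) (M := M)
  have h := isInvertible_mfderivWithin_extChartAt_symm (I := 𝓘(ℝ, E)) hy
  rwa [modelWithCornersSelf_coe, Set.range_id, mfderivWithin_univ] at h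

lemma chartFrame_inverse (hy : y ∈ (extChartAt 𝓘(ℝ, E) p).target)
    (v : TangentSpace 𝓘(ℝ, E) ((extChartAt 𝓘(ℝ, E) p).symm y)) :
    chartFrame p y ((chartFrame p y).inverse v) = v :=
  (isInvertible_chartFrame hy).self_apply_inverse v

lemma inverse_chartFrame (hy : y ∈ (extChartAt 𝓘(ℝ, E) p).target) (v : E) :
    (chartFrame p y).inverse (chartFrame p y v) = v :=
  (isInvertible_chartFrame hy).inverse_apply_self v

lemma coordinateField_symm (hy : y ∈ (extChartAt 𝓘(ℝ, E) p).target) (v : E) :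
    coordinateField p v ((extChartAt 𝓘(ℝ, E) p).symm y) = chartFrame p y v := by
  have := isManifold_one (E := E) (M := M)
  have hx := (extChartAt 𝓘(ℝ, E) p).map_target hy
  have hf := isInvertible_mfderiv_extChartAt (I := 𝓘(ℝ, E)) hx
  have h := mfderiv_extChartAt_comp_chartFrame hy v
  exact (congrArg (mfderiv 𝓘(ℝ, E) 𝓘(ℝ, E) (extChartAt 𝓘(ℝ, E) p)
    ((extChartAt 𝓘(ℝ, E) p).symm y)).inverse h.symm).trans (hf.inverse_apply_self _)

omit [IsManifold 𝓘(ℝ, E) ∞ M] in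
lemma vectorInChart_apply (X : ∀ x : M, TangentSpace 𝓘(ℝ, E) x) (p : M) (y : E) :
    vectorInChart X p y = (chartFrame p y).inverse (X ((extChartAt 𝓘(ℝ, E) p).symm y)) := rfl

lemma chartFrame_vectorInChart (hy : y ∈ (extChartAt 𝓘(ℝ, E) p).target)
    (X : ∀ x : M, TangentSpace 𝓘(ℝ, E) x) :
    chartFrame p y (vectorInChart X p y) = X ((extChartAt 𝓘(ℝ, E) p).symm y) :=
  chartFrame_inverse hy _

lemma vectorInChart_coordinateField (hy : y ∈ (extChartAt 𝓘(ℝ, E) p).target) (v : E) :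
    vectorInChart (coordinateField p v) p y = v := by
  rw [vectorInChart_apply, coordinateField_symm hy, inverse_chartFrame hy]

lemma chartFrame_endomorphismInChart (hy : y ∈ (extChartAt 𝓘(ℝ, E) p).target)
    (f : ∀ x : M, TangentSpace 𝓘(ℝ, E) x →L[ℝ] TangentSpace 𝓘(ℝ, E) x) (v : E) :
    chartFrame p y (endomorphismInChart f p y v) = f _ (chartFrame p y v) :=
  chartFrame_inverse hy _

omit [IsManifold 𝓘(ℝ, E) ∞ M] in
lemma formInChart_apply (η : ∀ x : M, TangentSpace 𝓘(ℝ, E) x →L[ℝ] ℝ) (v : E) :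
    formInChart η p y v = η _ (chartFrame p y v) := rfl

lemma inChart_apply (g : MetricTensor E M) (u v : E) :
    g.inChart p y u v = g.val _ (chartFrame p y u) (chartFrame p y v) := rfl

lemma vectorInChart_endomorphism (hy : y ∈ (extChartAt 𝓘(ℝ, E) p).target)
    (f : ∀ x : M, TangentSpace 𝓘(ℝ, E) x →L[ℝ] TangentSpace 𝓘(ℝ, E) x) (v : E) :
    vectorInChart (fun x => f x (coordinateField p v x)) p y = endomorphismInChart f p y v := by
  rw [vectorInChart_apply, coordinateField_symm hy]
  rfl

lemma contMDiffAt_extChartAt_symm (hy : y ∈ (extChartAt 𝓘(ℝ, E) p).target) :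
    ContMDiffAt 𝓘(ℝ, E) 𝓘(ℝ, E) ∞ (extChartAt 𝓘(ℝ, E) p).symm y :=
  (contMDiffOn_extChartAt_symm p).contMDiffAt ((isOpen_extChartAt_target p).mem_nhds hy)

variable [CompleteSpace E]

lemma smoothFieldOn_coordinateField (p : M) (v : E) :
    SmoothFieldOn (extChartAt 𝓘(ℝ, E) p).source (coordinateField p v) := by
  have := isManifold_one (E := E) (M := M)
  intro x hx
  refine ContMDiffAt.contMDiffWithinAt (ContMDiffAt.mpullback_vectorField_preimage (n := ∞) (m := ∞)
    ?_ (contMDiffAt_extChartAt' (by simpa using hx)) (isInvertible_mfderiv_extChartAt hx) (by simp))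
  exact contMDiffAt_vectorSpace_iff_contDiffAt.2 contDiffAt_const

lemma contDiffOn_vectorInChart {X : ∀ x : M, TangentSpace 𝓘(ℝ, E) x}
    (hX : SmoothFieldOn (extChartAt 𝓘(ℝ, E) p).source X) :
    ContDiffOn ℝ ∞ (vectorInChart X p) (extChartAt 𝓘(ℝ, E) p).target := by
  have := isManifold_one (E := E) (M := M)
  intro y hy
  have hx := (extChartAt 𝓘(ℝ, E) p).map_target hy
  have h0 := ContMDiffAt.mpullback_vectorField_preimage (n := ∞) (m := ∞)
    ((hX _ hx).contMDiffAt ((isOpen_extChartAt_source p).mem_nhds hx))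
    (contMDiffAt_extChartAt_symm hy) (isInvertible_chartFrame (E := E) hy) (by simp)
  have h : ContDiffAt ℝ ∞ (vectorInChart X p) y :=
    (contMDiffAt_vectorSpace_iff_contDiffAt (𝕜 := ℝ) (E := E) (V := vectorInChart X p)).1 h0
  exact h.contDiffWithinAt

omit [CompleteSpace E] in
lemma mlieBracket_eq_lieBracket (V W : E → E) (y : E) :
    VectorField.mlieBracket 𝓘(ℝ, E) V W y = VectorField.lieBracket ℝ V W y := by
  have h1 := congrFun (VectorField.mlieBracketWithin_eq_lieBracketWithin (𝕜 := ℝ) (V := V) (W := W)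
    (s := Set.univ)) y
  have h2 := congrFun (VectorField.mlieBracketWithin_univ (I := 𝓘(ℝ, E)) (V := V) (W := W)) y
  have h3 := congrFun (VectorField.lieBracketWithin_univ (𝕜 := ℝ) (V := V) (W := W)) y
  exact h2.symm.trans (h1.trans h3)

/-- The Lie bracket of vector fields in a chart. -/
lemma vectorInChart_mlieBracket {X Y : ∀ x : M, TangentSpace 𝓘(ℝ, E) x}
    (hX : SmoothFieldOn (extChartAt 𝓘(ℝ, E) p).source X)
    (hY : SmoothFieldOn (extChartAt 𝓘(ℝ, E) p).source Y)
    (hy : y ∈ (extChartAt 𝓘(ℝ, E) p).target) :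
    vectorInChart (VectorField.mlieBracket 𝓘(ℝ, E) X Y) p y
      = VectorField.lieBracket ℝ (vectorInChart X p) (vectorInChart Y p) y := by
  have : IsManifold 𝓘(ℝ, E) (minSmoothness ℝ 2) M := by
    rw [minSmoothness_of_isRCLikeNormedField]
    exact IsManifold.of_le (n := ∞) ENat.LEInfty.out
  have hx := (extChartAt 𝓘(ℝ, E) p).map_target hy
  have hd : ∀ {X : ∀ x : M, TangentSpace 𝓘(ℝ, E) x},
      SmoothFieldOn (extChartAt 𝓘(ℝ, E) p).source X → MDifferentiableAt 𝓘(ℝ, E) 𝓘(ℝ, E).tangent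
        (fun x => TotalSpace.mk' E (E := fun x : M => TangentSpace 𝓘(ℝ, E) x) x (X x))
        ((extChartAt 𝓘(ℝ, E) p).symm y) := fun {X} hX =>
    ((hX _ hx).contMDiffAt ((isOpen_extChartAt_source p).mem_nhds hx)).mdifferentiableAt (by simp)
  have h := VectorField.mpullback_mlieBracket (hd hX) (hd hY)
    ((contMDiffAt_extChartAt_symm hy).of_le (m := 2) ENat.LEInfty.out) (by simp)
  exact h.trans (mlieBracket_eq_lieBracket _ _ y)

/-- The bracket is natural under the inverse chart. As the target is open, the coordinate
expressions may be replaced by any `A`, `B` agreeing with them there, such as constants. -/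
lemma mlieBracket_symm {X Y : ∀ x : M, TangentSpace 𝓘(ℝ, E) x} {A B : E → E}
    (hX : SmoothFieldOn (extChartAt 𝓘(ℝ, E) p).source X)
    (hY : SmoothFieldOn (extChartAt 𝓘(ℝ, E) p).source Y)
    (hA : ∀ z ∈ (extChartAt 𝓘(ℝ, E) p).target, vectorInChart X p z = A z)
    (hB : ∀ z ∈ (extChartAt 𝓘(ℝ, E) p).target, vectorInChart Y p z = B z)
    (hy : y ∈ (extChartAt 𝓘(ℝ, E) p).target) :
    VectorField.mlieBracket 𝓘(ℝ, E) X Y ((extChartAt 𝓘(ℝ, E) p).symm y)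
      = chartFrame p y (fderiv ℝ B y (A y) - fderiv ℝ A y (B y)) := by
  have hn := (isOpen_extChartAt_target (I := 𝓘(ℝ, E)) p).mem_nhds hy
  have hA' : vectorInChart X p =ᶠ[nhds y] A := by filter_upwards [hn] with z hz using hA z hz
  have hB' : vectorInChart Y p =ᶠ[nhds y] B := by filter_upwards [hn] with z hz using hB z hz
  rw [← chartFrame_vectorInChart hy (VectorField.mlieBracket 𝓘(ℝ, E) X Y), vectorInChart_mlieBracket hX hY hy, VectorField.lieBracket,
    hA'.fderiv_eq, hB'.fderiv_eq, hA'.eq_of_nhds, hB'.eq_of_nhds]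

omit [CompleteSpace E] in
lemma contDiffOn_comp_symm {f : M → ℝ}
    (hf : ContMDiffOn 𝓘(ℝ, E) 𝓘(ℝ, ℝ) ∞ f (extChartAt 𝓘(ℝ, E) p).source) :
    ContDiffOn ℝ ∞ (fun y => f ((extChartAt 𝓘(ℝ, E) p).symm y)) (extChartAt 𝓘(ℝ, E) p).target :=
  contMDiffOn_iff_contDiffOn.1 <| hf.comp (contMDiffOn_extChartAt_symm p)
    fun _ hy => (extChartAt 𝓘(ℝ, E) p).map_target hy

omit [CompleteSpace E] in
lemma mvfderiv_chartFrame {f : M → ℝ}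
    (hf : ContMDiffOn 𝓘(ℝ, E) 𝓘(ℝ, ℝ) ∞ f (extChartAt 𝓘(ℝ, E) p).source)
    (hy : y ∈ (extChartAt 𝓘(ℝ, E) p).target) (v : E) :
    mvfderiv 𝓘(ℝ, E) f ((extChartAt 𝓘(ℝ, E) p).symm y) (chartFrame p y v)
      = fderiv ℝ (fun z => f ((extChartAt 𝓘(ℝ, E) p).symm z)) y v := by
  have hx := (extChartAt 𝓘(ℝ, E) p).map_target hy
  have h1 : MDifferentiableAt 𝓘(ℝ, E) 𝓘(ℝ, ℝ) f ((extChartAt 𝓘(ℝ, E) p).symm y) :=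
    ((hf _ hx).contMDiffAt ((isOpen_extChartAt_source p).mem_nhds hx)).mdifferentiableAt (by simp)
  have h2 := (contMDiffAt_extChartAt_symm hy).mdifferentiableAt (by simp)
  have h3 := mfderiv_comp_apply y h1 h2 v
  rw [mfderiv_eq_fderiv] at h3
  exact h3.symm

omit [CompleteSpace E] in
omit [IsManifold 𝓘(ℝ, E) ∞ M] in
lemma contMDiffOn_of_trivial {f : M → ℝ} {U : Set M}
    (hf : ContMDiffOn 𝓘(ℝ, E) (𝓘(ℝ, E).prod 𝓘(ℝ, ℝ)) ∞
      (fun x => TotalSpace.mk' ℝ (E := Bundle.Trivial M ℝ) x (f x)) U) :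
    ContMDiffOn 𝓘(ℝ, E) 𝓘(ℝ, ℝ) ∞ f U := by
  intro x hx
  have := hf x hx
  simp only [contMDiffWithinAt_totalSpace] at this
  exact this.2

omit [CompleteSpace E] in
lemma contMDiffOn_metric (g : MetricTensor E M) {U : Set M}
    {X Y : ∀ x : M, TangentSpace 𝓘(ℝ, E) x} (hX : SmoothFieldOn U X) (hY : SmoothFieldOn U Y) :
    ContMDiffOn 𝓘(ℝ, E) 𝓘(ℝ, ℝ) ∞ (fun x => g.val x (X x) (Y x)) U := by
  apply contMDiffOn_of_trivial
  apply ContMDiffOn.clm_bundle_apply₂ (F₁ := E) (F₂ := E)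
  · exact g.contMDiff.contMDiffOn
  · exact hX
  · exact hY

omit [CompleteSpace E] in
lemma contMDiffOn_form (S : TensorTriple E M) {U : Set M}
    {X : ∀ x : M, TangentSpace 𝓘(ℝ, E) x} (hX : SmoothFieldOn U X) :
    ContMDiffOn 𝓘(ℝ, E) 𝓘(ℝ, ℝ) ∞ (fun x => S.η x (X x)) U := by
  apply contMDiffOn_of_trivial
  apply ContMDiffOn.clm_bundle_apply (F₁ := E)
  · exact S.contMDiff_η.contMDiffOn
  · exact hX

omit [CompleteSpace E] in
lemma smoothFieldOn_endomorphism (S : TensorTriple E M) {U : Set M}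
    {X : ∀ x : M, TangentSpace 𝓘(ℝ, E) x} (hX : SmoothFieldOn U X) :
    SmoothFieldOn U (fun x => S.φ x (X x)) := by
  apply ContMDiffOn.clm_bundle_apply (F₁ := E)
  · exact S.contMDiff_φ.contMDiffOn
  · exact hX

end Chart

/-! ### Transport of metrics and (para)Sasakian structures to a chart. -/

section Transport

variable {E : Type*} [NormedAddCommGroup E] [NormedSpace ℝ E]
  {M : Type*} [TopologicalSpace M] [ChartedSpace E M] [IsManifold 𝓘(ℝ, E) ∞ M]

lemma inChart_symm (g : MetricTensor E M) (p : M) (y u v : E) :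
    g.inChart p y u v = g.inChart p y v u :=
  g.symm _ (chartFrame p y u) (chartFrame p y v)

lemma inChart_nondegenerate (g : MetricTensor E M) {p : M} {y : E}
    (hy : y ∈ (extChartAt 𝓘(ℝ, E) p).target) (u : E) (hu : ∀ w, g.inChart p y u w = 0) :
    u = 0 := by
  have h1 : chartFrame p y u = 0 := g.nondegenerate _ _ fun w =>
    (congrArg (g.val _ (chartFrame p y u)) (chartFrame_inverse hy w)).symm.trans (hu _)
  exact (isInvertible_chartFrame (E := E) hy).injective (h1.trans (map_zero (chartFrame p y)).symm)

variable [FiniteDimensional ℝ E]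

lemma contDiffOn_inChart (g : MetricTensor E M) (p : M) :
    ContDiffOn ℝ ∞ (g.inChart p) (extChartAt 𝓘(ℝ, E) p).target := by
  have := FiniteDimensional.complete ℝ E
  have h : ∀ u v, ContDiffOn ℝ ∞ (fun y => g.inChart p y u v) (extChartAt 𝓘(ℝ, E) p).target :=
    fun u v => (contDiffOn_comp_symm (contMDiffOn_metric g
      (smoothFieldOn_coordinateField (E := E) p u)
      (smoothFieldOn_coordinateField (E := E) p v))).congr fun y hy =>
        congrArg₂ (fun a b => g.val _ a b) (coordinateField_symm hy u).symm
          (coordinateField_symm hy v).symm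
  exact contDiffOn_clm_apply.2 fun u => contDiffOn_clm_apply.2 (h u)

lemma isMetricOn_inChart (g : MetricTensor E M) (p : M) :
    IsMetricOn (g.inChart p) (extChartAt 𝓘(ℝ, E) p).target where
  isOpen := isOpen_extChartAt_target p
  contDiffOn := contDiffOn_inChart g p
  symm y _ := inChart_symm g p y
  nondegenerate _ hy u hu := inChart_nondegenerate g hy u hu

/-- The data of a compatible (para)contact metric structure with explicit signs. -/
structure IsSasakianWith (S : TensorTriple E M) (g : MetricTensor E M) (r ε : ℝ) : Prop where
  r_mul_r : r * r = 1
  ε_mul_ε : ε * ε = 1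
  η_ξ : ∀ x, S.η x (S.ξ x) = 1
  φ_φ : ∀ x v, S.φ x (S.φ x v) = -(r • (v - S.η x v • S.ξ x))
  g_ξ_ξ : ∀ x, g.val x (S.ξ x) (S.ξ x) = ε
  g_φ_φ : ∀ x v w, g.val x (S.φ x v) (S.φ x w) = r * (g.val x v w - ε * (S.η x v * S.η x w))
  contact : S.IsContactForm g
  normal : S.IsNormal r

variable {S : TensorTriple E M} {g : MetricTensor E M} {r ε : ℝ}

/-- Coordinate fields commute, so the bracket term drops out; the factor `2` absorbs the
normalization of `dη`. -/
lemma extDerivOne_coordinateField (S : TensorTriple E M) {p : M} {y : E}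
    (hy : y ∈ (extChartAt 𝓘(ℝ, E) p).target) (u v : E) :
    2 * extDerivOne S.η (coordinateField p u) (coordinateField p v)
        ((extChartAt 𝓘(ℝ, E) p).symm y)
      = fderiv ℝ (fun z => formInChart S.η p z v) y u
        - fderiv ℝ (fun z => formInChart S.η p z u) y v := by
  have := FiniteDimensional.complete ℝ E
  have hs := smoothFieldOn_coordinateField (E := E) (M := M) p
  have hn := (isOpen_extChartAt_target (I := 𝓘(ℝ, E)) p).mem_nhds hy
  have key : ∀ u v, mvfderiv 𝓘(ℝ, E) (fun x => S.η x (coordinateField p v x))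
      ((extChartAt 𝓘(ℝ, E) p).symm y) (coordinateField p u ((extChartAt 𝓘(ℝ, E) p).symm y))
      = fderiv ℝ (fun z => formInChart S.η p z v) y u := fun u v => by
    rw [coordinateField_symm hy, mvfderiv_chartFrame (contMDiffOn_form S (hs v)) hy]
    have : (fun z => S.η _ (coordinateField p v ((extChartAt 𝓘(ℝ, E) p).symm z)))
        =ᶠ[nhds y] fun z => formInChart S.η p z v := by
      filter_upwards [hn] with z hz
      rw [coordinateField_symm hz, formInChart_apply]
    rw [this.fderiv_eq]
  have hb := mlieBracket_symm (A := fun _ => u) (B := fun _ => v) (hs u) (hs v)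
    (fun z hz => vectorInChart_coordinateField hz u)
    (fun z hz => vectorInChart_coordinateField hz v) hy
  rw [fderiv_fun_const, fderiv_fun_const] at hb
  simp only [Pi.zero_apply, zero_apply, sub_self, map_zero] at hb
  rw [extDerivOne, key, key, hb, map_zero]
  ring

lemma nijenhuis_coordinateField (S : TensorTriple E M) {p : M} {y : E}
    (hy : y ∈ (extChartAt 𝓘(ℝ, E) p).target) (v w : E)
    (hφ : DifferentiableAt ℝ (endomorphismInChart S.φ p) y) :
    nijenhuis S.φ (coordinateField p v) (coordinateField p w) ((extChartAt 𝓘(ℝ, E) p).symm y)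
      = chartFrame p y (fderiv ℝ (endomorphismInChart S.φ p) y (endomorphismInChart S.φ p y v) w
        - fderiv ℝ (endomorphismInChart S.φ p) y (endomorphismInChart S.φ p y w) v
        + endomorphismInChart S.φ p y (fderiv ℝ (endomorphismInChart S.φ p) y w v)
        - endomorphismInChart S.φ p y (fderiv ℝ (endomorphismInChart S.φ p) y v w)) := by
  have := FiniteDimensional.complete ℝ E
  have hs := smoothFieldOn_coordinateField (E := E) (M := M) p
  have hsφ := fun v => smoothFieldOn_endomorphism S (hs v)
  have hc := fun v : E => fun z => fun hz : z ∈ (extChartAt 𝓘(ℝ, E) p).target =>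
    vectorInChart_coordinateField hz v
  have hcφ := fun v : E => fun z => fun hz : z ∈ (extChartAt 𝓘(ℝ, E) p).target =>
    vectorInChart_endomorphism hz S.φ v
  have hd : ∀ u v, fderiv ℝ (fun z => endomorphismInChart S.φ p z v) y u
      = fderiv ℝ (endomorphismInChart S.φ p) y u v := fun u v => by
    rw [fderiv_clm_apply hφ (differentiableAt_const v)]
    simp
  have b1 := mlieBracket_symm (A := fun _ => v) (B := fun _ => w) (hs v) (hs w) (hc v) (hc w) hy
  have b2 := mlieBracket_symm (hsφ v) (hsφ w) (hcφ v) (hcφ w) hy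
  have b3 := mlieBracket_symm (B := fun _ => w) (hsφ v) (hs w) (hcφ v) (hc w) hy
  have b4 := mlieBracket_symm (A := fun _ => v) (hs v) (hsφ w) (hc v) (hcφ w) hy
  rw [fderiv_fun_const] at b3 b4
  rw [fderiv_fun_const, fderiv_fun_const] at b1
  simp only [Pi.zero_apply, zero_apply, sub_self, map_zero, hd, zero_sub, sub_zero] at b1 b2 b3 b4
  rw [nijenhuis, b1, b2, b3, b4, ← chartFrame_endomorphismInChart hy,
    ← chartFrame_endomorphismInChart hy]
  simp only [map_zero, map_add, map_sub, map_neg, zero_add]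
  abel

/-- A (para)Sasakian structure in a chart. -/
lemma IsSasakianWith.isSasakianOn (h : IsSasakianWith S g r ε) (p : M) :
    IsSasakianOn (g.inChart p) (endomorphismInChart S.φ p) (vectorInChart S.ξ p)
      (formInChart S.η p) r ε (extChartAt 𝓘(ℝ, E) p).target := by
  have := FiniteDimensional.complete ℝ E
  have hs := smoothFieldOn_coordinateField (E := E) (M := M) p
  have hso := isOpen_extChartAt_source (I := 𝓘(ℝ, E)) p
  have hφ : ContDiffOn ℝ ∞ (endomorphismInChart S.φ p) (extChartAt 𝓘(ℝ, E) p).target :=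
    contDiffOn_clm_apply.2 fun v =>
      (contDiffOn_vectorInChart (smoothFieldOn_endomorphism S (hs v))).congr fun y hy =>
        (vectorInChart_endomorphism hy S.φ v).symm
  have hη : ContDiffOn ℝ ∞ (formInChart S.η p) (extChartAt 𝓘(ℝ, E) p).target :=
    contDiffOn_clm_apply.2 fun v => (contDiffOn_comp_symm (contMDiffOn_form S (hs v))).congr
      fun y hy => by rw [formInChart_apply, coordinateField_symm hy]
  refine { isMetricOn_inChart g p with
    contDiffOn_φ := hφ
    contDiffOn_ξ := contDiffOn_vectorInChart S.contMDiff_ξ.contMDiffOn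
    contDiffOn_η := hη
    linear := fun y hy => ?_
    contact := fun y hy u v => ?_
    normal := fun y hy v w => ?_ }
  · exact
    { symm := (isMetricOn_inChart g p).symm y hy
      nondegenerate := (isMetricOn_inChart g p).nondegenerate y hy
      r_mul_r := h.r_mul_r
      ε_mul_ε := h.ε_mul_ε
      η_ξ := by rw [formInChart_apply, chartFrame_vectorInChart hy, h.η_ξ]
      φ_φ := fun v => by
        apply (isInvertible_chartFrame hy).injective
        rw [chartFrame_endomorphismInChart hy, chartFrame_endomorphismInChart hy, h.φ_φ, map_neg,
          map_smul, map_sub, map_smul, chartFrame_vectorInChart hy, formInChart_apply]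
      g_ξ_ξ := by rw [inChart_apply, chartFrame_vectorInChart hy, h.g_ξ_ξ]
      g_φ_φ := fun u v => by
        rw [inChart_apply, chartFrame_endomorphismInChart hy, chartFrame_endomorphismInChart hy,
          h.g_φ_φ]
        rfl }
  · have hx := (extChartAt 𝓘(ℝ, E) p).map_target hy
    -- Coordinate fields exist only on the chart domain, which is why the hypothesis is applied to
    -- fields smooth on an open set.
    have h1 := h.contact _ hso _ _ (hs u) (hs v) _ hx
    have hd : ∀ u v, fderiv ℝ (fun z => formInChart S.η p z v) y u
        = fderiv ℝ (formInChart S.η p) y u v := fun u v => by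
      rw [fderiv_clm_apply ((hη.contDiffAt ((isOpen_extChartAt_target p).mem_nhds
        hy)).differentiableAt (by simp)) (differentiableAt_const v)]
      simp
    rw [← hd, ← hd, ← extDerivOne_coordinateField S hy, h1, coordinateField_symm hy,
      coordinateField_symm hy, inChart_apply, chartFrame_endomorphismInChart hy]
  · have hx := (extChartAt 𝓘(ℝ, E) p).map_target hy
    have h1 := h.contact _ hso _ _ (hs v) (hs w) _ hx
    have h2 := h.normal _ hso _ _ (hs v) (hs w) _ hx
    rw [h1, nijenhuis_coordinateField S hy v w ((hφ.contDiffAt ((isOpen_extChartAt_target p).mem_nhds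
        hy)).differentiableAt (by simp)), coordinateField_symm hy, coordinateField_symm hy,
      ← chartFrame_endomorphismInChart hy, ← chartFrame_vectorInChart hy S.ξ,
      ← map_smul, ← map_add] at h2
    exact (isInvertible_chartFrame hy).injective (h2.trans (map_zero _).symm)

end Transport

/-! ### Signs of the characteristic vector fields and the scalar curvature on the manifold. -/

section Mixed

variable {E : Type*} [NormedAddCommGroup E] [NormedSpace ℝ E]
  {M : Type*} [TopologicalSpace M] [ChartedSpace E M] [IsManifold 𝓘(ℝ, E) ∞ M]
  {g : MetricTensor E M}

/-- In the paracontact case `φ² u = u` means `η u = 0`, and compatibility then reverses the sign.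
Applied to `u = ξ_b`, this compares the causal characters of different `ξ_a`. -/
lemma IsSasakianWith.g_φ_self_eq_neg {S : TensorTriple E M} {ε : ℝ}
    (h : IsSasakianWith S g (-1) ε) (x : M) {u : TangentSpace 𝓘(ℝ, E) x}
    (hu : S.φ x (S.φ x u) = u) :
    g.val x (S.φ x u) (S.φ x u) = -g.val x u u := by
  have h1 : S.η x u = 0 := by
    have h2 := h.φ_φ x u
    rw [hu, neg_smul, neg_neg, one_smul] at h2
    have h3 := congrArg (S.η x) h2
    rw [map_sub, map_smul, h.η_ξ, smul_eq_mul, mul_one, sub_self] at h3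
    exact h3
  rw [h.g_φ_φ, h1]
  ring

variable {S : Fin 3 → TensorTriple E M}

lemma IsMixedThreeSasakian.isSasakianWith (hS : IsMixedThreeSasakian g S) :
    ∃ ε : Fin 3 → ℝ, ∀ a, (ε a = 1 ∨ ε a = -1) ∧ IsSasakianWith (S a) g (τ a) (ε a) := by
  choose ε hε using hS.mixedMetric.compatible
  refine ⟨ε, fun a => ⟨(hε a).1, ?_⟩⟩
  have hεa : ε a * ε a = 1 := by rcases (hε a).1 with h | h <;> rw [h] <;> norm_num
  have hη : ∀ x, (S a).η x ((S a).ξ x) = 1 := by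
    fin_cases a
    exacts [fun x => (hS.paraSasakian₁.1 x).1, fun x => (hS.paraSasakian₂.1 x).1,
      fun x => (hS.sasakian₃.1 x).1]
  have hφ : ∀ x v, (S a).φ x ((S a).φ x v) = -(τ a • (v - (S a).η x v • (S a).ξ x)) := by
    fin_cases a
    · intro x v
      simpa [τ] using (hS.paraSasakian₁.1 x).2 v
    · intro x v
      simpa [τ] using (hS.paraSasakian₂.1 x).2 v
    · intro x v
      simpa [τ, sub_eq_add_neg, add_comm] using (hS.sasakian₃.1 x).2 v
  have hc : (S a).IsContactForm g := by
    fin_cases a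
    exacts [hS.paraSasakian₁.2.2.1, hS.paraSasakian₂.2.2.1, hS.sasakian₃.2.2.1]
  have hn : (S a).IsNormal (τ a) := by
    fin_cases a
    exacts [hS.paraSasakian₁.2.2.2, hS.paraSasakian₂.2.2.2, hS.sasakian₃.2.2.2]
  have hr : τ a * τ a = 1 := by fin_cases a <;> simp [τ]
  exact ⟨hr, hεa, hη, hφ, fun x => ((hε a).2 x).1, fun x => ((hε a).2 x).2, hc, hn⟩

/-- The signs `ε_a = g(ξ_a, ξ_a)` of a mixed 3-Sasakian structure satisfy `ε₁ = ε₂ = -ε₃`. -/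
lemma IsMixedThreeSasakian.signs (hS : IsMixedThreeSasakian g S) {ε : Fin 3 → ℝ}
    (h : ∀ a, IsSasakianWith (S a) g (τ a) (ε a)) (x : M) : ε 2 = -ε 1 ∧ ε 2 = -ε 0 := by
  obtain ⟨-, -, -, -, h1, h2⟩ := hS.mixedMetric.mixed.relations 0 1 2 rfl rfl x
  obtain ⟨-, -, -, -, h3, -⟩ := hS.mixedMetric.mixed.relations 1 2 0 rfl rfl x
  obtain ⟨-, -, -, -, -, h4⟩ := hS.mixedMetric.mixed.relations 2 0 1 rfl rfl x
  have t0 : τ 0 = -1 := rfl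
  have t1 : τ 1 = -1 := rfl
  have t2 : τ 2 = 1 := rfl
  rw [t1, neg_smul, one_smul] at h1
  rw [t0, neg_smul, one_smul, neg_neg] at h2
  rw [t2, one_smul] at h3 h4
  have k0 := h 0
  have k1 := h 1
  rw [t0] at k0
  rw [t1] at k1
  -- In code indices, `φ₀` sends `ξ₁` to `-ξ₂` and `ξ₂` to `-ξ₁`, while `φ₁` exchanges `ξ₀` and
  -- `ξ₂`.
  have e1 := k0.g_φ_self_eq_neg x (u := (S 1).ξ x) (by rw [h1, map_neg, h4, neg_neg])
  have e0 := k1.g_φ_self_eq_neg x (u := (S 0).ξ x) (by rw [h2, h3])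
  rw [h1, map_neg, g.val x |>.map_neg₂, neg_neg, (h 2).g_ξ_ξ, (h 1).g_ξ_ξ] at e1
  rw [h2, (h 2).g_ξ_ξ, (h 0).g_ξ_ξ] at e0
  exact ⟨e1, e0⟩

variable [FiniteDimensional ℝ E]

/-- The scalar curvature of a mixed 3-Sasakian manifold. -/
lemma IsMixedThreeSasakian.scalarCurvature_eq (hS : IsMixedThreeSasakian g S) {ε : Fin 3 → ℝ}
    (h : ∀ a, IsSasakianWith (S a) g (τ a) (ε a)) (p : M) :
    g.scalarCurvature p = -ε 0 * (Module.finrank ℝ E - 1) * Module.finrank ℝ E := by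
  have hy := mem_extChartAt_target (I := 𝓘(ℝ, E)) p
  obtain ⟨s1, s0⟩ := hS.signs h p
  obtain ⟨r1, r2, -⟩ := hS.mixedMetric.mixed.relations 0 1 2 rfl rfl
    ((extChartAt 𝓘(ℝ, E) p).symm (extChartAt 𝓘(ℝ, E) p p))
  refine scalar_eq_of_isSasakianOn (a := τ 0) (b := τ 1) (s := τ 2)
    (fun a => (h a).isSasakianOn p) hy (fun a => ?_) ?_ (fun v => ?_) fun v => ?_
  -- All three products `τ a * ε a` equal `-ε 0`, by `ε 0 = ε 1 = -ε 2`.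
  · fin_cases a <;> simp [τ] <;> linarith
  · simp [τ]
  · apply (isInvertible_chartFrame (E := E) hy).injective
    rw [map_sub, map_smul, map_smul, chartFrame_endomorphismInChart hy,
      chartFrame_endomorphismInChart hy, chartFrame_endomorphismInChart hy,
      chartFrame_vectorInChart hy, formInChart_apply]
    exact r1 _
  · apply (isInvertible_chartFrame (E := E) hy).injective
    rw [map_add, map_neg, map_smul, map_smul, chartFrame_endomorphismInChart hy,
      chartFrame_endomorphismInChart hy, chartFrame_endomorphismInChart hy,
      chartFrame_vectorInChart hy, formInChart_apply]
    exact r2 _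

end Mixed

end MixedThreeSasakian

/-! ### The main theorem. -/

theorem mainTheorem3 (n : ℕ)
    {E : Type*} [NormedAddCommGroup E] [NormedSpace ℝ E] [FiniteDimensional ℝ E]
    (hE : Module.finrank ℝ E = 4 * n + 3)
    {M : Type*} [TopologicalSpace M] [T2Space M] [SecondCountableTopology M]
    [ChartedSpace E M] [IsManifold 𝓘(ℝ, E) ∞ M]
    (g : MixedThreeSasakian.MetricTensor E M)
    (S : Fin 3 → MixedThreeSasakian.TensorTriple E M)
    (hS : MixedThreeSasakian.IsMixedThreeSasakian g S) :
    (∃ σ : ℝ,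
      ((MixedThreeSasakian.IsPositive g S ∧ σ = 1) ∨
        (MixedThreeSasakian.IsNegative g S ∧ σ = -1)) ∧
      ∀ p : M, g.scalarCurvature p = -σ * (4 * (n : ℝ) + 2) * (4 * (n : ℝ) + 3)) ∧
    (MixedThreeSasakian.IsPositive g S → ∀ p : M, g.scalarCurvature p < 0) ∧
    (MixedThreeSasakian.IsNegative g S → ∀ p : M, 0 < g.scalarCurvature p) := by
  obtain ⟨ε, hε⟩ := hS.isSasakianWith
  have h := fun a => (hε a).2
  have hsc : ∀ p, g.scalarCurvature p = -ε 0 * (4 * (n : ℝ) + 2) * (4 * (n : ℝ) + 3) :=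
    fun p => by
      rw [hS.scalarCurvature_eq h p, hE]
      push_cast
      ring
  have hs : ∀ x : M, g.val x ((S 0).ξ x) ((S 0).ξ x) = ε 0 ∧
      g.val x ((S 1).ξ x) ((S 1).ξ x) = ε 0 := fun x => by
    obtain ⟨s1, s0⟩ := hS.signs h x
    exact ⟨(h 0).g_ξ_ξ x, ((h 1).g_ξ_ξ x).trans (by linarith)⟩
  have hn : 0 < (4 * (n : ℝ) + 2) * (4 * (n : ℝ) + 3) := by positivity
  -- The sign `σ` is `ε 0`, a single constant for all of `M`. If `M` is empty, either sign works.
  refine ⟨⟨ε 0, ?_, hsc⟩, fun hp p => ?_, fun hp p => ?_⟩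
  · rcases (hε 0).1 with h0 | h0
    · exact Or.inl ⟨fun x => h0 ▸ hs x, h0⟩
    · exact Or.inr ⟨fun x => h0 ▸ hs x, h0⟩
  · have h0 : ε 0 = 1 := (hs p).1.symm.trans (hp p).1
    rw [hsc, h0]
    linarith
  · have h0 : ε 0 = -1 := (hs p).1.symm.trans (hp p).1
    rw [hsc, h0]
    linarith
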